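/- **Conventions.** Let $\mathcal K$ be an augmented virtual double category (Koudenburg): it has objects, a category of vertical morphisms $f\colon A\to C$, horizontal morphisms $J\colon A⇸B$, and cells $\phi\colon \underline J\Rightarrow \underline K$ from a path $\underline J=(J_1,\dots,J_n)\colon A_0⇸A_n$ ($n\ge 0$) to a path $\underline K\colon C⇸D$ of length $1$ (unary cells) or $0$ (nullary cells; then $C=D$), with a vertical source $A_0\to C$ and a vertical target $A_n\to D$; cells compose vertically, $\psi\circ(\phi_1,\dots,\phi_n)$, and there are identity cells. Nullary cells $\eta\colon\underline J\Rightarrow M$, $\zeta\colon\underline H\Rightarrow M$ have a horizontal composite $\eta\odot\zeta=\mathrm{id}_M\circ(\eta,\zeta)$. "Factors uniquely" always refers to these compositions. * A cell $\psi\colon J\Rightarrow\underline K$ with vertical morphisms $f,g$ is *cartesian*, and defines $J$ as the *restriction* $\underline K(f,g)$, if every cell $\underline H\Rightarrow\underline K$ with vertical morphisms of the form $f\circ h$, $g\circ k$ factors uniquely through $\psi$. For $f\colon A\to C$ the *conjoint* is $f^*=C(\mathrm{id},f)$. $\mathcal K$ is *unital* if all $I_A=A(\mathrm{id},\mathrm{id})$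 exist. * A nullary cell $\eta\colon\underline J\Rightarrow M$ with vertical source $d$ and target $l$ is *left Kan* (*weakly left Kan*) if every nullary cell $\underline J\frown\underline H\Rightarrow M$ with vertical source $d$, for any path $\underline H$ (respectively for $\underline H$ empty), factors uniquely as $\eta\odot\phi'$. The (weak) left Kan extension of $d$ along $\underline J$ ($n\geq1$) *restricts along* $g$ if $J_n(\mathrm{id},g)$ exists and for every (weakly) left Kan $\eta\colon\underline J\Rightarrow M$ with vertical source $d$ the composite $\eta\circ(\mathrm{id},\dots,\mathrm{id},\mathrm{cart})$ is (weakly) left Kan, where $\mathrm{cart}$ defines $J_n(\mathrm{id},g)$; $\eta$ is *pointwise* (weakly) left Kan if it is (weakly) left Kan and these composites are so for every $g$ for which $J_n(\mathrm{id},g)$ exists. * $\mathrm y\colon C\to P$ is a *(weak) Yoneda morphism* if every cartesian cell $J\Rightarrow P$ with vertical source $\mathrm y$ is (weakly) left Kan, and for every $J\colon C⇸B$ there are $l\colon B\to P$ and a cartesian cell $J\Rightarrow P$ with vertical morphisms $\mathrm y,l$. It *admits nullary restrictions* if $P(\mathrm y,k)$ exists for all $k\colon B\to P$. * A path $\underline\phi$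 of cells is *weakly nullary-cocartesian* (*weakly unary-cocartesian*) if every nullary (unary) cell with the concatenated horizontal source of $\underline\phi$, and with vertical morphisms that factor through those of $\underline\phi$, factors uniquely through $\underline\phi$. It is *right nullary-(unary-)cocartesian* if moreover $\underline\phi\frown(\mathrm{cart},\mathrm{id}_{K_2},\dots,\mathrm{id}_{K_q})$ is weakly nullary-(unary-)cocartesian for all non-empty paths $(K_1,\dots,K_q)$ for which $K_1(f,\mathrm{id})$ exists, where $f$ is the vertical target of $\underline\phi$ and $\mathrm{cart}$ defines $K_1(f,\mathrm{id})$. *Right (respectively weakly) cocartesian* means both the nullary and the unary variant. A cell $\phi\colon\underline J\Rightarrow K$ with trivial vertical target, $n\ge1$, is *pointwise* so if it is so and, for every $h$ such that $J_n(\mathrm{id},h)$ exists, $K(\mathrm{id},h)$ exists and the unique $\phi_h$ with $\phi\circ(\mathrm{id},\dots,\mathrm{id},\mathrm{cart})=\mathrm{cart}\circ\phi_h$ is so. * A cell $\phi\colon\underline J\Rightarrow K$ with vertical source $f\colon A_0\to C$ is *(weakly) left $d$-exact*, for $d\colon C\to M$, if $\eta\circ\phi$ is (weakly) left Kan for every (weakly)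 left Kan $\eta\colon K\Rightarrow M$ with vertical source $d$; *pointwise (weakly) left $d$-exact* if the same holds with "pointwise (weakly) left Kan" throughout; and *pointwise (weakly) left exact* if this holds for all $d$. With vertical target $g$, it satisfies the *(pointwise) (weak) left Beck–Chevalley condition* if $K(\mathrm{id},g)$ exists and the unique $\phi'$ with $\phi=\mathrm{cart}\circ\phi'$ is (pointwise) right (respectively weakly) nullary-cocartesian. **Theorem.** Let $\mathrm y\colon C\to P$ be a (weak) Yoneda morphism. Let $\phi\colon\underline J=(J_1,\dots,J_n)\Rightarrow K$ be a cell with $K\colon C⇸D$, vertical source $f\colon A_0\to C$ and vertical target $g\colon A_n\to D$, and suppose that $\phi=\mathrm{cart}\circ\phi'$, where $\mathrm{cart}$ is a cartesian cell defining the restriction $K(\mathrm{id},g)\colon C⇸A_n$ and $\phi'\colon\underline J\Rightarrow K(\mathrm{id},g)$ has vertical morphisms $f$ and $\mathrm{id}_{A_n}$. Assume that either $f=\mathrm{id}_C$ or the conjoint $f^*$ exists. Consider the conditions: * (a) $\phi'$ is right (respectively weakly) nullary-cocartesian; * (b) $\phi$ satisfies the (weak) left Beck–Chevalley condition; * (c)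 $\phi$ is (weakly) left $d$-exact for every $d\colon C\to M$ whose (weak) left Kan extension along $K$ restricts along $g$; * (d) $\phi$ is (weakly) left $\mathrm y$-exact; * (e) $\phi'$ is right (respectively weakly) unary-cocartesian. Then: 1. (a) $\Leftrightarrow$ (b) $\Rightarrow$ (c) $\Rightarrow$ (d). 2. If the restrictions $L(h,\mathrm{id})$ exist for all horizontal $L\colon X⇸Y$ and vertical $h\colon C\to X$, then (d) $\Rightarrow$ (e). If $\mathrm y$ admits nullary restrictions, then (e) $\Rightarrow$ (d). 3. All five conditions are equivalent if there exists a right (respectively weakly) cocartesian cell $\underline J\Rightarrow K''$, for some horizontal morphism $K''\colon C⇸A_n$, with vertical morphisms $f$ and $\mathrm{id}_{A_n}$; and also if $\mathcal K$ is unital and the restrictions $L(h,\mathrm{id})$ of 2 exist. If moreover $n\ge1$ and the restrictions $K(\mathrm{id},g\circ h)$ exist for all $h\colon X\to A_n$, then 1, 2 and 3 hold as well for the pointwise variants of the conditions: (a), (b), (d), (e) (and the cocartesian cell in 3) with "pointwise" added throughout, and (c) replaced by (c') $\phi$ is pointwise (weakly) left exact. -/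

import Mathlib

open CategoryTheory

universe u v w x

set_option linter.checkUnivs false

namespace AVDC

/-- A (possibly empty) path `(J₁, …, Jₙ)` of horizontal morphisms. -/
inductive HPath {Ob : Type u} (H : Ob → Ob → Type w) : Ob → Ob → Type (max u w)
  | nil (A : Ob) : HPath H A A
  | cons {A B C : Ob} (J : H A B) (p : HPath H B C) : HPath H A C

namespace HPath

variable {Ob : Type u} {H : Ob → Ob → Type w}

/-- Concatenation of paths. -/
def append : {A B C : Ob} → HPath H A B → HPath H B C → HPath H A C
  | _, _, _, nil _, q => q
  | _, _, _, cons J p, q => cons J (append p q)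

theorem append_nil : {A B : Ob} → (p : HPath H A B) → p.append (nil B) = p
  | _, _, nil _ => rfl
  | _, _, cons J p => congrArg (cons J) (append_nil p)

theorem append_assoc : {A B C D : Ob} → (p : HPath H A B) → (q : HPath H B C) →
    (r : HPath H C D) → (p.append q).append r = p.append (q.append r)
  | _, _, _, _, nil _, _, _ => rfl
  | _, _, _, _, cons J p, q, r => congrArg (cons J) (append_assoc p q r)

/-- The path `(J₁, …, Jₙ, J)`. -/
def snoc {A B C : Ob} (p : HPath H A B) (J : H B C) : HPath H A C :=
  p.append (cons J (nil C))

def length : {A B : Ob} → HPath H A B → ℕ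
  | _, _, nil _ => 0
  | _, _, cons _ p => p.length + 1

end HPath

/-- A path of length at most one: the possible horizontal targets of cells. -/
inductive Target {Ob : Type u} (H : Ob → Ob → Type w) : Ob → Ob → Type (max u w)
  | empty (C : Ob) : Target H C C
  | single {C D : Ob} (K : H C D) : Target H C D

def Target.toPath {Ob : Type u} {H : Ob → Ob → Type w} :
    {C D : Ob} → Target H C D → HPath H C D
  | _, _, .empty C => .nil C
  | _, _, .single K => .cons K (.nil _)

/-- Horizontal morphisms and cells over a category of objects and vertical morphisms. The type
`Cell J f g K` consists of the cells with horizontal source `J`, horizontal target `K`, vertical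
source `f` and vertical target `g`; they are unary or nullary according to the length of `K`. -/
class CellData (Ob : Type u) [Category.{v} Ob] where
  Hor : Ob → Ob → Type w
  Cell : {A B C D : Ob} → HPath Hor A B → (A ⟶ C) → (B ⟶ D) → Target Hor C D → Type x

open CellData (Hor Cell)

section Paths

variable {Ob : Type u} [Category.{v} Ob] [CellData.{u, v, w, x} Ob]

/-- A non-empty path `(φ₁, …, φₙ)` of cells in which the vertical target of each `φᵢ` is the
vertical source of `φᵢ₊₁`. The indices are the concatenation of the horizontal sources, the vertical
source of `φ₁`, the vertical target of `φₙ`, and the concatenation of the horizontal targets. -/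
inductive CellPath : {A B C D : Ob} → HPath (Hor (Ob := Ob)) A B → (A ⟶ C) → (B ⟶ D) →
    HPath (Hor (Ob := Ob)) C D → Type (max u v w x)
  | single {A B C D : Ob} {J : HPath Hor A B} {f : A ⟶ C} {g : B ⟶ D} {K : Target Hor C D}
      {K' : HPath Hor C D} (φ : Cell J f g K) (hK : K' = K.toPath) : CellPath J f g K'
  | cons {A B C D E F : Ob} {J : HPath Hor A B} {f : A ⟶ C} {g : B ⟶ D} {K : Target Hor C D}
      {J' : HPath Hor B E} {h : E ⟶ F} {K' : HPath Hor D F}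
      {J'' : HPath Hor A E} {K'' : HPath Hor C F}
      (φ : Cell J f g K) (p : CellPath J' g h K')
      (hJ : J'' = J.append J') (hK : K'' = K.toPath.append K') : CellPath J'' f h K''

/-- A cell regarded as a path of length one. -/
def CellPath.of {A B C D : Ob} {J : HPath (Hor (Ob := Ob)) A B} {f : A ⟶ C} {g : B ⟶ D}
    {K : Target Hor C D} (φ : Cell J f g K) : CellPath J f g K.toPath :=
  .single φ rfl

/-- Concatenation of paths of cells. -/
def CellPath.append : {A B C D E F : Ob} → {J : HPath (Hor (Ob := Ob)) A B} → {f : A ⟶ C} →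
    {g : B ⟶ D} → {K : HPath (Hor (Ob := Ob)) C D} → {J' : HPath (Hor (Ob := Ob)) B E} →
    {h : E ⟶ F} → {K' : HPath (Hor (Ob := Ob)) D F} → {J'' : HPath (Hor (Ob := Ob)) A E} →
    {K'' : HPath (Hor (Ob := Ob)) C F} →
    CellPath J f g K → CellPath J' g h K' → J'' = J.append J' → K'' = K.append K' →
    CellPath J'' f h K''
  | _, _, _, _, _, _, _, _, _, _, _, _, _, _, _, .single φ hK₀, q, hJ, hK =>
      .cons φ q hJ (by rw [hK, hK₀])
  | _, _, _, _, _, _, _, _, _, _, _, _, _, _, _, .cons φ p hJ₀ hK₀, q, hJ, hK =>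
      .cons φ (p.append q rfl rfl) (by rw [hJ, hJ₀, HPath.append_assoc])
        (by rw [hK, hK₀, HPath.append_assoc])

/-- A non-empty path of pairs `(φ̲ᵢ, ψᵢ)`, where `φ̲ᵢ` is a path of cells whose horizontal target is
the horizontal source of `ψᵢ`: two rows of a pasting diagram, stacked on top of each other. -/
inductive TwoRows : {A B C D E F : Ob} → HPath (Hor (Ob := Ob)) A B → (A ⟶ C) → (B ⟶ D) →
    HPath (Hor (Ob := Ob)) C D → (C ⟶ E) → (D ⟶ F) → HPath (Hor (Ob := Ob)) E F →
    Type (max u v w x)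
  | single {A B C D E F : Ob} {J : HPath Hor A B} {f : A ⟶ C} {g : B ⟶ D} {K : HPath Hor C D}
      {h : C ⟶ E} {k : D ⟶ F} {L : Target Hor E F} {L' : HPath Hor E F}
      (p : CellPath J f g K) (ψ : Cell K h k L) (hL : L' = L.toPath) : TwoRows J f g K h k L'
  | cons {A B C D E F A' C' E' : Ob} {J : HPath Hor A B} {f : A ⟶ C} {g : B ⟶ D}
      {K : HPath Hor C D} {h : C ⟶ E} {k : D ⟶ F} {L : Target Hor E F}
      {J' : HPath Hor B A'} {g' : A' ⟶ C'} {K' : HPath Hor D C'} {k' : C' ⟶ E'}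
      {L' : HPath Hor F E'} {J'' : HPath Hor A A'} {K'' : HPath Hor C C'} {L'' : HPath Hor E E'}
      (p : CellPath J f g K) (ψ : Cell K h k L) (r : TwoRows J' g g' K' k k' L')
      (hJ : J'' = J.append J') (hK : K'' = K.append K') (hL : L'' = L.toPath.append L') :
      TwoRows J'' f g' K'' h k' L''

/-- The upper row `φ̲₁ ⌢ ⋯ ⌢ φ̲ₙ`. -/
def TwoRows.top : {A B C D E F : Ob} → {J : HPath (Hor (Ob := Ob)) A B} → {f : A ⟶ C} →
    {g : B ⟶ D} → {K : HPath (Hor (Ob := Ob)) C D} → {h : C ⟶ E} → {k : D ⟶ F} →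
    {L : HPath (Hor (Ob := Ob)) E F} → TwoRows J f g K h k L → CellPath J f g K
  | _, _, _, _, _, _, _, _, _, _, _, _, _, .single p _ _ => p
  | _, _, _, _, _, _, _, _, _, _, _, _, _, .cons p _ r hJ hK _ => p.append r.top hJ hK

/-- The lower row `(ψ₁, …, ψₙ)`. -/
def TwoRows.bot : {A B C D E F : Ob} → {J : HPath (Hor (Ob := Ob)) A B} → {f : A ⟶ C} →
    {g : B ⟶ D} → {K : HPath (Hor (Ob := Ob)) C D} → {h : C ⟶ E} → {k : D ⟶ F} →
    {L : HPath (Hor (Ob := Ob)) E F} → TwoRows J f g K h k L → CellPath K h k L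
  | _, _, _, _, _, _, _, _, _, _, _, _, _, .single _ ψ hL => .single ψ hL
  | _, _, _, _, _, _, _, _, _, _, _, _, _, .cons _ ψ r _ hK hL => .cons ψ r.bot hK hL

/-- Transport of a cell along equalities of its vertical source and target. -/
def castCell {A B C D : Ob} {J : HPath (Hor (Ob := Ob)) A B} {f f' : A ⟶ C} {g g' : B ⟶ D}
    {K : Target Hor C D} (hf : f = f') (hg : g = g') (φ : Cell J f g K) : Cell J f' g' K :=
  hf ▸ hg ▸ φ

end Paths

/-- The operations of an augmented virtual double category: vertical composition
`ψ ∘ (φ₁, …, φₙ)`, horizontal identity cells `id_J`, and vertical identity cells `id_f`. -/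
class CompData (Ob : Type u) [Category.{v} Ob] extends CellData.{u, v, w, x} Ob where
  comp : {A B C D E F : Ob} → {J : HPath Hor A B} → {f : A ⟶ C} → {g : B ⟶ D} →
    {K : HPath Hor C D} → {h : C ⟶ E} → {k : D ⟶ F} → {L : Target Hor E F} →
    CellPath J f g K → Cell K h k L → Cell J (f ≫ h) (g ≫ k) L
  hid : {A B : Ob} → (J : Hor A B) → Cell (.cons J (.nil B)) (𝟙 A) (𝟙 B) (.single J)
  vid : {A C : Ob} → (f : A ⟶ C) → Cell (.nil A) f f (.empty C)

open CompData (comp hid vid)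

section Operations

variable {Ob : Type u} [Category.{v} Ob] [CompData.{u, v, w, x} Ob]

/-- The path of length one consisting of the vertical identity cell `id_f`. -/
def vidPath {A C : Ob} (f : A ⟶ C) : CellPath (.nil A : HPath (Hor (Ob := Ob)) A A) f f (.nil C) :=
  .single (vid f) rfl

/-- The path `(id_{J₁}, …, id_{Jₙ})`, which is `(id_A)` if `n = 0`. -/
def ids : {A B : Ob} → (J : HPath (Hor (Ob := Ob)) A B) → CellPath J (𝟙 A) (𝟙 B) J
  | _, _, .nil A => .single (vid (𝟙 A)) rfl
  | _, _, .cons J (.nil _) => .single (hid J) rfl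
  | _, _, .cons J (.cons J' p) => .cons (hid J) (ids (.cons J' p)) rfl rfl

/-- The path `(ψ₁ ∘ φ̲₁, …, ψₙ ∘ φ̲ₙ)`. -/
def TwoRows.composites : {A B C D E F : Ob} → {J : HPath (Hor (Ob := Ob)) A B} → {f : A ⟶ C} →
    {g : B ⟶ D} → {K : HPath (Hor (Ob := Ob)) C D} → {h : C ⟶ E} → {k : D ⟶ F} →
    {L : HPath (Hor (Ob := Ob)) E F} → TwoRows J f g K h k L → CellPath J (f ≫ h) (g ≫ k) L
  | _, _, _, _, _, _, _, _, _, _, _, _, _, .single p ψ hL => .single (comp p ψ) hL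
  | _, _, _, _, _, _, _, _, _, _, _, _, _, .cons p ψ r hJ _ hL =>
      .cons (comp p ψ) r.composites hJ hL

end Operations

end AVDC

open AVDC in
/-- An augmented virtual double category with `Ob` as category of objects and vertical morphisms. -/
class AugmentedVirtualDoubleCategory (Ob : Type u) [Category.{v} Ob] extends
    CompData.{u, v, w, x} Ob where
  /-- `χ ∘ (ψ₁ ∘ φ̲₁, …, ψₙ ∘ φ̲ₙ) = (χ ∘ (ψ₁, …, ψₙ)) ∘ (φ̲₁ ⌢ ⋯ ⌢ φ̲ₙ)` -/
  comp_assoc : ∀ {A B C D E F G H : Ob} {J : HPath Hor A B} {f : A ⟶ C} {g : B ⟶ D}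
    {K : HPath Hor C D} {h : C ⟶ E} {k : D ⟶ F} {L : HPath Hor E F} (r : TwoRows J f g K h k L)
    {l : E ⟶ G} {m : F ⟶ H} {N : Target Hor G H} (χ : Cell L l m N),
    castCell (Category.assoc f h l) (Category.assoc g k m) (comp r.composites χ) =
      comp r.top (comp r.bot χ)
  /-- `id_h ∘ id_f = id_{h ∘ f}` -/
  vid_comp_vid : ∀ {A C E : Ob} (f : A ⟶ C) (h : C ⟶ E),
    comp (vidPath f) (vid h) = vid (f ≫ h)
  /-- `id_C ∘ φ = φ` for nullary cells `φ` -/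
  vid_comp : ∀ {A B C : Ob} {J : HPath Hor A B} {f : A ⟶ C} {g : B ⟶ C}
    (φ : Cell J f g (.empty C)),
    castCell (Category.comp_id f) (Category.comp_id g) (comp (CellPath.of φ) (vid (𝟙 C))) = φ
  /-- `id_K ∘ φ = φ` for unary cells `φ` -/
  hid_comp : ∀ {A B C D : Ob} {J : HPath Hor A B} {f : A ⟶ C} {g : B ⟶ D} {K : Hor C D}
    (φ : Cell J f g (.single K)),
    castCell (Category.comp_id f) (Category.comp_id g) (comp (CellPath.of φ) (hid K)) = φ
  /-- `ψ ∘ (id_{J₁}, …, id_{Jₙ}) = ψ`, where the path is `(id_A)` if `n = 0` -/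
  comp_ids : ∀ {A B C D : Ob} {J : HPath Hor A B} {f : A ⟶ C} {g : B ⟶ D} {K : Target Hor C D}
    (ψ : Cell J f g K),
    castCell (Category.id_comp f) (Category.id_comp g) (comp (ids J) ψ) = ψ
  /-- `ψ ∘ (φ₁, …, φᵢ, id_{fᵢ}, φᵢ₊₁, …, φₙ) = ψ ∘ (φ₁, …, φₙ)` for `0 < i < n` -/
  comp_insert : ∀ {A B C D A' C' E F : Ob} {J : HPath Hor A B} {f : A ⟶ C} {g : B ⟶ D}
    {K : HPath Hor C D} {J' : HPath Hor B A'} {g' : A' ⟶ C'} {K' : HPath Hor D C'}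
    {h : C ⟶ E} {k : C' ⟶ F} {L : Target Hor E F}
    (p : CellPath J f g K) (q : CellPath J' g g' K') (ψ : Cell (K.append K') h k L),
    comp (p.append ((vidPath g).append q rfl rfl) rfl rfl) ψ =
      comp (p.append q rfl rfl) ψ
  /-- the preceding axiom for `i = 0` -/
  comp_insert_left : ∀ {A B C D E F : Ob} {J : HPath Hor A B} {f : A ⟶ C} {g : B ⟶ D}
    {K : HPath Hor C D} {h : C ⟶ E} {k : D ⟶ F} {L : Target Hor E F}
    (p : CellPath J f g K) (ψ : Cell K h k L),
    comp ((vidPath f).append p rfl rfl) ψ = comp p ψ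
  /-- the preceding axiom for `i = n` -/
  comp_insert_right : ∀ {A B C D E F : Ob} {J : HPath Hor A B} {f : A ⟶ C} {g : B ⟶ D}
    {K : HPath Hor C D} {h : C ⟶ E} {k : D ⟶ F} {L : Target Hor E F}
    (p : CellPath J f g K) (ψ : Cell K h k L),
    comp (p.append (vidPath g) (HPath.append_nil J).symm (HPath.append_nil K).symm) ψ =
      comp p ψ

namespace AVDC

open CellData (Hor Cell)

open CompData (comp hid vid)

/-- Selects between a notion and its weak variant. -/
inductive Strength
  | plain
  | weak

/-- Selects between the nullary and the unary variants of cocartesianness. -/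
inductive Arity
  | nullary
  | unary

/-- `L` is empty, respectively has length one. -/
def Target.HasArity {Ob : Type u} {H : Ob → Ob → Type w} {C D : Ob} :
    Arity → Target H C D → Prop
  | .nullary, .empty _ => True
  | .nullary, .single _ => False
  | .unary, .empty _ => False
  | .unary, .single _ => True

section Notions

variable {Ob : Type u} [Category.{v} Ob] [AugmentedVirtualDoubleCategory.{u, v, w, x} Ob]

/-- A cell `ψ : J ⇒ K`, with `J` of length at most one, is cartesian if every cell with horizontal
target `K` whose vertical morphisms factor through those of `ψ` factors uniquely through `ψ`. -/
def IsCartesian {A B C D : Ob} {J : Target (Hor (Ob := Ob)) A B} {f : A ⟶ C} {g : B ⟶ D}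
    {K : Target Hor C D} (ψ : Cell J.toPath f g K) : Prop :=
  ∀ ⦃X Y : Ob⦄ (h : X ⟶ A) (k : Y ⟶ B) (H : HPath Hor X Y) (χ : Cell H (h ≫ f) (k ≫ g) K),
    ∃! χ' : Cell H h k J, comp (CellPath.of χ') ψ = χ

/-- The horizontal morphism `J` is the restriction `K(f, g)`, with defining cell `ψ`. -/
abbrev IsRestriction {A B C D : Ob} {J : Hor A B} {f : A ⟶ C} {g : B ⟶ D}
    {K : Target (Hor (Ob := Ob)) C D} (ψ : Cell (.cons J (.nil B)) f g K) : Prop :=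
  IsCartesian (J := .single J) ψ

/-- The restriction `K(f, g)` exists. If `K` is empty it is the nullary restriction `C(f, g)`. -/
def HasRestriction {A B C D : Ob} (K : Target (Hor (Ob := Ob)) C D) (f : A ⟶ C) (g : B ⟶ D) :
    Prop :=
  ∃ (J : Hor A B) (ψ : Cell (.cons J (.nil B)) f g K), IsRestriction ψ

/-- The conjoint `f^* = C(id, f)` of `f : A ⟶ C` exists. -/
def HasConjoint {A C : Ob} (f : A ⟶ C) : Prop :=
  HasRestriction (.empty C) (𝟙 C) f

variable (Ob) in
/-- All horizontal units `I_A = A(id, id)` exist. -/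
def IsUnital : Prop :=
  ∀ A : Ob, HasRestriction (.empty A) (𝟙 A) (𝟙 A)

/-- The horizontal composite `id_M ∘ (η, ζ)` of nullary cells `η : J ⇒ M` and `ζ : H ⇒ M`. -/
def hcomp {A B E M : Ob} {J : HPath (Hor (Ob := Ob)) A B} {H : HPath (Hor (Ob := Ob)) B E}
    {J' : HPath Hor A E} {d : A ⟶ M} {l : B ⟶ M} {k : E ⟶ M} (η : Cell J d l (.empty M))
    (ζ : Cell H l k (.empty M)) (hJ : J' = J.append H) : Cell J' d k (.empty M) :=
  castCell (Category.comp_id d) (Category.comp_id k)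
    (comp ((CellPath.of η).append (CellPath.of ζ) hJ rfl) (vid (𝟙 M)))

/-- The nullary cell `η` defines `l` as the weak left Kan extension of `d` along `J`. -/
def IsWeaklyLeftKan {A B M : Ob} {J : HPath (Hor (Ob := Ob)) A B} {d : A ⟶ M} {l : B ⟶ M}
    (η : Cell J d l (.empty M)) : Prop :=
  ∀ (k : B ⟶ M) (φ : Cell J d k (.empty M)),
    ∃! φ' : Cell (.nil B) l k (.empty M), hcomp η φ' (HPath.append_nil J).symm = φ

/-- The nullary cell `η` defines `l` as the left Kan extension of `d` along `J`. -/
def IsLeftKan {A B M : Ob} {J : HPath (Hor (Ob := Ob)) A B} {d : A ⟶ M} {l : B ⟶ M}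
    (η : Cell J d l (.empty M)) : Prop :=
  ∀ ⦃E : Ob⦄ (H : HPath Hor B E) (k : E ⟶ M) (φ : Cell (J.append H) d k (.empty M)),
    ∃! φ' : Cell H l k (.empty M), hcomp η φ' rfl = φ

/-- `η` is (weakly) left Kan. -/
def IsKan (s : Strength) {A B M : Ob} {J : HPath (Hor (Ob := Ob)) A B} {d : A ⟶ M} {l : B ⟶ M}
    (η : Cell J d l (.empty M)) : Prop :=
  match s with
  | .plain => IsLeftKan η
  | .weak => IsWeaklyLeftKan η

/-- The path of cells `(id_{J₁}, …, id_{Jₙ₋₁}, c)` with horizontal target `J = (J₁, …, Jₙ)`,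
where `J₀ = (J₁, …, Jₙ₋₁)`. (If `n = 1` it is `(id_A, c)`; composing with it is the same as
composing with `c`.) -/
def restrictLast {A B Z X : Ob} {J : HPath (Hor (Ob := Ob)) A B} (J₀ : HPath Hor A Z)
    {Jn : Hor Z B} (hJ : J = J₀.snoc Jn) {g : X ⟶ B} {Jn' : Hor Z X}
    (c : Cell (.cons Jn' (.nil X)) (𝟙 Z) g (.single Jn)) :
    CellPath (J₀.snoc Jn') (𝟙 A) g J :=
  (ids J₀).append (CellPath.of c) rfl hJ

/-- The (weak) left Kan extension of `d` along the path `(J₀, Jn)` restricts along `g`. -/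
def KanExtensionRestricts (s : Strength) {A B Z M X : Ob} (d : A ⟶ M)
    (J₀ : HPath (Hor (Ob := Ob)) A Z) (Jn : Hor Z B) (g : X ⟶ B) : Prop :=
  HasRestriction (.single Jn) (𝟙 Z) g ∧
    ∀ (l : B ⟶ M) (η : Cell (J₀.snoc Jn) d l (.empty M)), IsKan s η →
      ∀ (Jn' : Hor Z X) (c : Cell (.cons Jn' (.nil X)) (𝟙 Z) g (.single Jn)), IsRestriction c →
        IsKan s (comp (restrictLast J₀ rfl c) η)

/-- `η`, whose horizontal source `J` is meant to be non-empty, is pointwise (weakly) left Kan: it is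
(weakly) left Kan and restricts along every `g` for which the restriction `Jₙ(id, g)` exists. -/
def IsPointwiseKan (s : Strength) {A B M : Ob} {J : HPath (Hor (Ob := Ob)) A B} {d : A ⟶ M}
    {l : B ⟶ M} (η : Cell J d l (.empty M)) : Prop :=
  IsKan s η ∧
    ∀ ⦃Z : Ob⦄ (J₀ : HPath Hor A Z) (Jn : Hor Z B) (hJ : J = J₀.snoc Jn) ⦃X : Ob⦄ (g : X ⟶ B)
      (Jn' : Hor Z X) (c : Cell (.cons Jn' (.nil X)) (𝟙 Z) g (.single Jn)), IsRestriction c →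
        IsKan s (comp (restrictLast J₀ hJ c) η)

/-- `f` is (weakly) dense. -/
def IsDense (s : Strength) {A M : Ob} (f : A ⟶ M) : Prop :=
  ∀ ⦃B : Ob⦄ (J : Hor A B) (l : B ⟶ M) (η : Cell (.cons J (.nil B)) f l (.empty M)),
    IsRestriction η → IsKan s η

/-- `y : C ⟶ P` is a (weak) Yoneda morphism. -/
def IsYoneda (s : Strength) {C P : Ob} (y : C ⟶ P) : Prop :=
  IsDense s y ∧
    ∀ ⦃B : Ob⦄ (J : Hor C B), ∃ (l : B ⟶ P) (c : Cell (.cons J (.nil B)) y l (.empty P)),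
      IsRestriction c

/-- The nullary restrictions `P(y, k)` exist, for all `k : B ⟶ P`. -/
def AdmitsNullaryRestrictions {C P : Ob} (y : C ⟶ P) : Prop :=
  ∀ ⦃B : Ob⦄ (k : B ⟶ P), HasRestriction (.empty P) y k

/-- The restrictions `L(h, id)` exist, for all `L : X ⇸ Y` and `h : C ⟶ X`. -/
def HasRestrictionsOnLeftFrom (C : Ob) : Prop :=
  ∀ ⦃X Y : Ob⦄ (L : Hor X Y) (h : C ⟶ X), HasRestriction (.single L) h (𝟙 Y)

/-- The path of cells `p` is weakly nullary-cocartesian, respectively weakly unary-cocartesian. -/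
def IsWeaklyCocartesian (t : Arity) {A B C D : Ob} {J : HPath (Hor (Ob := Ob)) A B} {f : A ⟶ C}
    {g : B ⟶ D} {K : HPath Hor C D} (p : CellPath J f g K) : Prop :=
  ∀ ⦃X Y : Ob⦄ (h : C ⟶ X) (k : D ⟶ Y) (L : Target Hor X Y), L.HasArity t →
    ∀ χ : Cell J (f ≫ h) (g ≫ k) L, ∃! χ' : Cell K h k L, comp p χ' = χ

/-- The path of cells `p` is right nullary-cocartesian, respectively right unary-cocartesian: it is
weakly so and remains weakly so after concatenation with every path `(c, id_{K₂}, …, id_{K_q})`,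
where `c` defines a restriction `K₁(g, id)` along the vertical target `g` of `p`. (If `q = 1` a
vertical identity cell is added at the end, which does not change composites.) -/
def IsRightCocartesian (t : Arity) {A B C D : Ob} {J : HPath (Hor (Ob := Ob)) A B} {f : A ⟶ C}
    {g : B ⟶ D} {K : HPath Hor C D} (p : CellPath J f g K) : Prop :=
  IsWeaklyCocartesian t p ∧
    ∀ ⦃Y₁ Y : Ob⦄ (K₁ : Hor D Y₁) (Ks : HPath Hor Y₁ Y) (K₁' : Hor B Y₁)
      (c : Cell (.cons K₁' (.nil Y₁)) g (𝟙 Y₁) (.single K₁)), IsRestriction c →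
        IsWeaklyCocartesian t
          (p.append ((CellPath.of c).append (ids Ks) rfl rfl) rfl rfl)

/-- The path `p` is right (respectively weakly) nullary- or unary-cocartesian. -/
def IsCocartesian (s : Strength) (t : Arity) {A B C D : Ob} {J : HPath (Hor (Ob := Ob)) A B}
    {f : A ⟶ C} {g : B ⟶ D} {K : HPath Hor C D} (p : CellPath J f g K) : Prop :=
  match s with
  | .plain => IsRightCocartesian t p
  | .weak => IsWeaklyCocartesian t p

/-- A cell `φ : J ⇒ K` with trivial vertical target, and whose horizontal source `J` is meant to be
non-empty, is pointwise right (respectively weakly) nullary- or unary-cocartesian: it is so without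
`pointwise`, and for every `h` such that the restriction `Jₙ(id, h)` exists, say with defining cell
`c`, the restriction `K(id, h)` exists, say with defining cell `c'`, and the unique `φ'` with
`φ ∘ (id, …, id, c) = c' ∘ φ'` is again right (respectively weakly) nullary- or
unary-cocartesian. -/
def IsPointwiseCocartesian (s : Strength) (t : Arity) {A B C : Ob}
    {J : HPath (Hor (Ob := Ob)) A B} {f : A ⟶ C} {K : Hor C B} (φ : Cell J f (𝟙 B) (.single K)) :
    Prop :=
  IsCocartesian s t (CellPath.of φ) ∧
    ∀ ⦃Z : Ob⦄ (J₀ : HPath Hor A Z) (Jn : Hor Z B) (hJ : J = J₀.snoc Jn) ⦃X : Ob⦄ (h : X ⟶ B)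
      (Jn' : Hor Z X) (c : Cell (.cons Jn' (.nil X)) (𝟙 Z) h (.single Jn)), IsRestriction c →
        ∃ (K' : Hor C X) (c' : Cell (.cons K' (.nil X)) (𝟙 C) h (.single K))
          (φ' : Cell (J₀.snoc Jn') f (𝟙 X) (.single K')),
          IsRestriction c' ∧
          castCell (Category.id_comp f) (Category.comp_id h) (comp (restrictLast J₀ hJ c) φ) =
            castCell (Category.comp_id f) (Category.id_comp h) (comp (CellPath.of φ') c') ∧
          IsCocartesian s t (CellPath.of φ')

/-- The path `p` is (weakly) left `d`-exact. -/
def IsLeftExactAt (s : Strength) {A B C D M : Ob} {J : HPath (Hor (Ob := Ob)) A B} {f : A ⟶ C}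
    {g : B ⟶ D} {K : HPath Hor C D} (p : CellPath J f g K) (d : C ⟶ M) : Prop :=
  ∀ (l : D ⟶ M) (η : Cell K d l (.empty M)), IsKan s η → IsKan s (comp p η)

/-- The path `p` is pointwise (weakly) left `d`-exact. -/
def IsPointwiseLeftExactAt (s : Strength) {A B C D M : Ob} {J : HPath (Hor (Ob := Ob)) A B}
    {f : A ⟶ C} {g : B ⟶ D} {K : HPath Hor C D} (p : CellPath J f g K) (d : C ⟶ M) : Prop :=
  ∀ (l : D ⟶ M) (η : Cell K d l (.empty M)), IsPointwiseKan s η → IsPointwiseKan s (comp p η)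

/-- The path `p` is pointwise (weakly) left exact. -/
def IsPointwiseLeftExact (s : Strength) {A B C D : Ob} {J : HPath (Hor (Ob := Ob)) A B}
    {f : A ⟶ C} {g : B ⟶ D} {K : HPath Hor C D} (p : CellPath J f g K) : Prop :=
  ∀ ⦃M : Ob⦄ (d : C ⟶ M), IsPointwiseLeftExactAt s p d

/-- `φ = c ∘ φ'`, where `φ'` has trivial vertical target and `c` has trivial vertical source. -/
def FactorsAs {A B C D : Ob} {J : HPath (Hor (Ob := Ob)) A B} {f : A ⟶ C} {g : B ⟶ D}
    {K : Target Hor C D} {K' : Hor C B} (φ : Cell J f g K)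
    (c : Cell (.cons K' (.nil B)) (𝟙 C) g K) (φ' : Cell J f (𝟙 B) (.single K')) : Prop :=
  φ = castCell (Category.comp_id f) (Category.id_comp g) (comp (CellPath.of φ') c)

/-- `φ` satisfies the (weak) left Beck–Chevalley condition. -/
def LeftBeckChevalley (s : Strength) {A B C D : Ob} {J : HPath (Hor (Ob := Ob)) A B} {f : A ⟶ C}
    {g : B ⟶ D} {K : Target Hor C D} (φ : Cell J f g K) : Prop :=
  ∃ (K' : Hor C B) (c : Cell (.cons K' (.nil B)) (𝟙 C) g K) (φ' : Cell J f (𝟙 B) (.single K')),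
    IsRestriction c ∧ FactorsAs φ c φ' ∧ IsCocartesian s .nullary (CellPath.of φ')

/-- `φ` satisfies the pointwise (weak) left Beck–Chevalley condition. -/
def PointwiseLeftBeckChevalley (s : Strength) {A B C D : Ob} {J : HPath (Hor (Ob := Ob)) A B}
    {f : A ⟶ C} {g : B ⟶ D} {K : Target Hor C D} (φ : Cell J f g K) : Prop :=
  ∃ (K' : Hor C B) (c : Cell (.cons K' (.nil B)) (𝟙 C) g K) (φ' : Cell J f (𝟙 B) (.single K')),
    IsRestriction c ∧ FactorsAs φ c φ' ∧ IsPointwiseCocartesian s .nullary φ'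

end Notions

end AVDC

/-! Everything rests on one observation (`isKan_comp_iff`). Let `ε : K' ⇒ M` be Kan with vertical
source `d`. By interchange, `(ε ∘ φ') ⊙ ζ = (ε ⊙ ζ) ∘ (φ', id, …, id)`, and `ζ ↦ ε ⊙ ζ` is
bijective. So `ε ∘ φ'` is Kan exactly when composition with `(φ', id, …, id)` is bijective on
nullary cells with vertical source `d`. Kan-ness of `ε ∘ φ'` is thus the part of
nullary-cocartesianness of `φ'` that concerns the single morphism `d`; this gives (a) ⇒ (c). For (c)
⇒ (d), a Kan cell out of a Yoneda morphism is cartesian, and so are its restrictions, which density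
makes Kan again.

The target of the test cells may be changed along any cartesian cell
(`cocartesianAt_cartesian_iff`). A unary target `L` with vertical source `h` becomes `L(h, id)`,
which the Yoneda axiom presents as a nullary restriction of `P` along `y`: hence (d) ⇒ (e).
Conversely, nullary cells into `P` become unary cells into `P(y, k)`: hence (e) ⇒ (d). With units,
nullary cells into `X` become unary cells into `I_X`: hence (e) ⇒ (a).

Given a cocartesian `ρ` instead, write `φ' = σ ∘ ρ`. Under (d), uniqueness of Kan extensions shows
that `σ` is cartesian (`IsYoneda.isHorIso`); under (e), uniqueness of factorizations inverts it
(`IsCocartesian.isHorIso`). As `σ` is invertible, `φ'` inherits all properties of `ρ`.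

The pointwise versions apply the same arguments to every restriction, since restrictions of `K'` are
restrictions of `K` (`exists_factor_of_hasRestriction`) and composites are compatible with them
(`compTo_restriction_eq`). -/

namespace AVDC

open CellData (Hor Cell)

open CompData (comp hid vid)

/-! ### Transport along equalities of vertical morphisms -/

section Casts

variable {Ob : Type u} [Category.{v} Ob] [CellData.{u, v, w, x} Ob]

theorem castCell_bijective {A B C D : Ob} {J : HPath (Hor (Ob := Ob)) A B} {f f' : A ⟶ C}
    {g g' : B ⟶ D} {K : Target Hor C D} (hf : f = f') (hg : g = g') :
    Function.Bijective (castCell hf hg : Cell J f g K → Cell J f' g' K) := by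
  subst hf hg
  exact Function.bijective_id

/-- Transport of a path of cells along equalities of its vertical source and target. -/
def castPath {A B C D : Ob} {J : HPath (Hor (Ob := Ob)) A B} {f f' : A ⟶ C} {g g' : B ⟶ D}
    {K : HPath Hor C D} (hf : f = f') (hg : g = g') (p : CellPath J f g K) : CellPath J f' g' K :=
  hf ▸ hg ▸ p

theorem castPath_single {A B C D : Ob} {J : HPath (Hor (Ob := Ob)) A B} {f f' : A ⟶ C}
    {g g' : B ⟶ D} {K : Target Hor C D} {K' : HPath Hor C D} (hf : f = f') (hg : g = g')
    (φ : Cell J f g K) (hK : K' = K.toPath) :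
    castPath hf hg (.single φ hK) = .single (castCell hf hg φ) hK := by
  subst hf hg
  rfl

theorem castPath_cons {A B C D E F : Ob} {J : HPath (Hor (Ob := Ob)) A B} {f f' : A ⟶ C}
    {g g' : B ⟶ D} {K : Target Hor C D} {J' : HPath Hor B E} {h h' : E ⟶ F} {K' : HPath Hor D F}
    {J'' : HPath Hor A E} {K'' : HPath Hor C F} (hf : f = f') (hg : g = g') (hh : h = h')
    (φ : Cell J f g K) (p : CellPath J' g h K') (hJ : J'' = J.append J')
    (hK : K'' = K.toPath.append K') :
    castPath hf hh (.cons φ p hJ hK) =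
      .cons (castCell hf hg φ) (castPath hg hh p) hJ hK := by
  subst hf hg hh
  rfl

end Casts

/-! ### Composites with prescribed vertical boundary -/

section Composites

variable {Ob : Type u} [Category.{v} Ob] [CompData.{u, v, w, x} Ob]

/-- The composite `ψ ∘ p`, with prescribed vertical source and target. -/
def compTo {A B C D E F : Ob} {J : HPath (Hor (Ob := Ob)) A B} {f : A ⟶ C} {g : B ⟶ D}
    {K : HPath Hor C D} {h : C ⟶ E} {k : D ⟶ F} {L : Target Hor E F} {f' : A ⟶ E} {g' : B ⟶ F}
    (p : CellPath J f g K) (ψ : Cell K h k L) (hf : f ≫ h = f') (hg : g ≫ k = g') :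
    Cell J f' g' L :=
  castCell hf hg (comp p ψ)

end Composites

/-! ### Associativity and unit laws up to transport -/

section Calculus

variable {Ob : Type u} [Category.{v} Ob] [AugmentedVirtualDoubleCategory.{u, v, w, x} Ob]

open AugmentedVirtualDoubleCategory

/-- The associativity axiom with every vertical composite replaced by a variable, so that later uses
need no casts. -/
theorem compTo_rows {A B C D E F G H : Ob} {J : HPath (Hor (Ob := Ob)) A B} {f : A ⟶ C}
    {g : B ⟶ D} {K : HPath Hor C D} {h : C ⟶ E} {k : D ⟶ F} {L : HPath Hor E F}
    (r : TwoRows J f g K h k L) {l : E ⟶ G} {m : F ⟶ H} {N : Target Hor G H} (χ : Cell L l m N)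
    {a : A ⟶ E} {b : B ⟶ F} (ha : f ≫ h = a) (hb : g ≫ k = b) {a' : C ⟶ G} {b' : D ⟶ H}
    (ha' : h ≫ l = a') (hb' : k ≫ m = b') {a'' : A ⟶ G} {b'' : B ⟶ H} (e₁ : a ≫ l = a'')
    (e₂ : b ≫ m = b'') (e₃ : f ≫ a' = a'') (e₄ : g ≫ b' = b'') :
    compTo (castPath ha hb r.composites) χ e₁ e₂ =
      compTo r.top (compTo r.bot χ ha' hb') e₃ e₄ := by
  subst ha hb ha' hb' e₃ e₄
  exact comp_assoc r χ

/-- `χ ∘ (ψ ∘ p) = (χ ∘ ψ) ∘ p` -/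
theorem compTo_assoc {A B C D E F G H : Ob} {J : HPath (Hor (Ob := Ob)) A B} {f : A ⟶ C}
    {g : B ⟶ D} {K : HPath Hor C D} {h : C ⟶ E} {k : D ⟶ F} {L : Target Hor E F}
    (p : CellPath J f g K) (ψ : Cell K h k L)
    {l : E ⟶ G} {m : F ⟶ H} {N : Target Hor G H} (χ : Cell L.toPath l m N)
    {a : A ⟶ E} {b : B ⟶ F} (ha : f ≫ h = a) (hb : g ≫ k = b) {a' : C ⟶ G} {b' : D ⟶ H}
    (ha' : h ≫ l = a') (hb' : k ≫ m = b') {a'' : A ⟶ G} {b'' : B ⟶ H} (e₁ : a ≫ l = a'')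
    (e₂ : b ≫ m = b'') (e₃ : f ≫ a' = a'') (e₄ : g ≫ b' = b'') :
    compTo (.of (compTo p ψ ha hb)) χ e₁ e₂ =
      compTo p (compTo (.of ψ) χ ha' hb') e₃ e₄ := by
  subst ha hb
  exact compTo_rows (.single p ψ rfl) χ rfl rfl ha' hb' e₁ e₂ e₃ e₄

/-- Associativity with the first column displayed. The rows of the other columns are free variables,
so that identity rows can be inserted in simplified form. -/
theorem compTo_cons {A B C D E F G H A' C' E' : Ob} {J : HPath (Hor (Ob := Ob)) A B} {f : A ⟶ C}
    {g : B ⟶ D} {K : Target Hor C D} {h : C ⟶ E} {k : D ⟶ F} {L : Target Hor E F}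
    (φ : Cell J f g K) (ψ : Cell K.toPath h k L)
    {J' : HPath Hor B A'} {g' : A' ⟶ C'} {K' : HPath Hor D C'} {k' : C' ⟶ E'}
    {L' : HPath Hor F E'} (r : TwoRows J' g g' K' k k' L') {J'' : HPath Hor A A'}
    {K'' : HPath Hor C C'} {L'' : HPath Hor E E'} (hJ : J'' = J.append J')
    (hK : K'' = K.toPath.append K') (hL : L'' = L.toPath.append L')
    {l : E ⟶ G} {m : E' ⟶ H} {N : Target Hor G H} (χ : Cell L'' l m N)
    {a : A ⟶ E} {b : B ⟶ F} {c : A' ⟶ E'} (ha : f ≫ h = a) (hb : g ≫ k = b) (hc : g' ≫ k' = c)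
    {a' : C ⟶ G} {b' : C' ⟶ H} (ha' : h ≫ l = a') (hb' : k' ≫ m = b') {a'' : A ⟶ G}
    {b'' : A' ⟶ H} (e₁ : a ≫ l = a'') (e₂ : c ≫ m = b'') (e₃ : f ≫ a' = a'') (e₄ : g' ≫ b' = b'')
    {p : CellPath J' g g' K'} {q : CellPath K' k k' L'} {pq : CellPath J' b c L'}
    (hp : r.top = p) (hq : r.bot = q) (hpq : castPath hb hc r.composites = pq) :
    compTo (.cons (compTo (.of φ) ψ ha hb) pq hJ hL) χ e₁ e₂ =
      compTo (.cons φ p hJ hK) (compTo (.cons ψ q hK hL) χ ha' hb') e₃ e₄ := by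
  subst hp hq hpq ha hb hc
  exact compTo_rows (.cons (.of φ) ψ r hJ hK hL) χ rfl rfl ha' hb' e₁ e₂ e₃ e₄

theorem compTo_ids {A B C D : Ob} {J : HPath (Hor (Ob := Ob)) A B} {f : A ⟶ C} {g : B ⟶ D}
    {K : Target Hor C D} (ψ : Cell J f g K) (hf : 𝟙 A ≫ f = f) (hg : 𝟙 B ≫ g = g) :
    compTo (ids J) ψ hf hg = ψ :=
  comp_ids ψ

theorem compTo_hid {A B C D : Ob} {J : HPath (Hor (Ob := Ob)) A B} {f : A ⟶ C} {g : B ⟶ D}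
    {K : Hor C D} (φ : Cell J f g (.single K)) (hf : f ≫ 𝟙 C = f) (hg : g ≫ 𝟙 D = g) :
    compTo (.of φ) (hid K) hf hg = φ :=
  hid_comp φ

theorem hid_compTo {A B C D : Ob} {J : Hor A B} {f : A ⟶ C} {g : B ⟶ D}
    {K : Target (Hor (Ob := Ob)) C D} (φ : Cell (.cons J (.nil B)) f g K) (hf : 𝟙 A ≫ f = f)
    (hg : 𝟙 B ≫ g = g) :
    compTo (.of (hid J)) φ hf hg = φ :=
  comp_ids φ

theorem compTo_vid {A B C : Ob} {J : HPath (Hor (Ob := Ob)) A B} {f : A ⟶ C} {g : B ⟶ C}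
    (φ : Cell J f g (.empty C)) (hf : f ≫ 𝟙 C = f) (hg : g ≫ 𝟙 C = g) :
    compTo (.of φ) (vid (𝟙 C)) hf hg = φ :=
  vid_comp φ

/-- The rows `(id_{J₁}, …, id_{Jₙ})` and `(id_{J₁}, …, id_{Jₙ})`. -/
def idRows : {A B : Ob} → (J : HPath (Hor (Ob := Ob)) A B) → TwoRows J (𝟙 A) (𝟙 B) J (𝟙 A) (𝟙 B) J
  | _, _, .nil A => .single (vidPath (𝟙 A)) (vid (𝟙 A)) rfl
  | _, _, .cons J (.nil _) => .single (.of (hid J)) (hid J) rfl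
  | _, _, .cons J (.cons J' p) => .cons (.of (hid J)) (hid J) (idRows (.cons J' p)) rfl rfl rfl

theorem idRows_top : {A B : Ob} → (J : HPath (Hor (Ob := Ob)) A B) → (idRows J).top = ids J
  | _, _, .nil A => rfl
  | _, _, .cons _ (.nil _) => rfl
  | _, _, .cons J (.cons J' p) =>
      congrArg (fun q => CellPath.cons (hid J) q rfl rfl) (idRows_top (.cons J' p))

theorem idRows_bot : {A B : Ob} → (J : HPath (Hor (Ob := Ob)) A B) → (idRows J).bot = ids J
  | _, _, .nil A => rfl
  | _, _, .cons _ (.nil _) => rfl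
  | _, _, .cons J (.cons J' p) =>
      congrArg (fun q => CellPath.cons (hid J) q rfl rfl) (idRows_bot (.cons J' p))

theorem castCell_vid {A C : Ob} {f f' : A ⟶ C} (h : f = f') :
    castCell h h (vid f : Cell (.nil A : HPath (Hor (Ob := Ob)) A A) f f (.empty C)) = vid f' := by
  subst h
  rfl

theorem idRows_composites : {A B : Ob} → (J : HPath (Hor (Ob := Ob)) A B) →
    castPath (Category.comp_id (𝟙 A)) (Category.comp_id (𝟙 B)) (idRows J).composites = ids J
  | _, _, .nil A =>
      (castPath_single (K := .empty A) _ _ (comp (vidPath (𝟙 A)) (vid (𝟙 A))) rfl).trans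
        (congrArg (fun φ => CellPath.single φ rfl)
          ((congrArg _ (vid_comp_vid (𝟙 A) (𝟙 A))).trans (castCell_vid _)))
  | _, _, .cons J (.nil _) =>
      (castPath_single (K := .single J) _ _ (comp (.of (hid J)) (hid J)) rfl).trans
        (congrArg (fun φ => CellPath.single φ rfl) (hid_comp (hid J)))
  | _, _, .cons J (.cons J' p) =>
      (castPath_cons (K := .single J) _ (Category.comp_id _) _ (comp (.of (hid J)) (hid J))
        (idRows (.cons J' p)).composites rfl rfl).trans
        (congrArg₂ (fun φ q => CellPath.cons φ q rfl rfl) (hid_comp (hid J))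
          (idRows_composites (.cons J' p)))

end Calculus

/-! ### Kan cells, cartesian cells and invertible cells -/

section Kan

variable {Ob : Type u} [Category.{v} Ob] [AugmentedVirtualDoubleCategory.{u, v, w, x} Ob]

open AugmentedVirtualDoubleCategory

theorem compTo_insert_right {A B C D E F : Ob} {J : HPath (Hor (Ob := Ob)) A B} {f : A ⟶ C}
    {g : B ⟶ D} {K : HPath Hor C D} {h : C ⟶ E} {k : D ⟶ F} {L : Target Hor E F} {f' : A ⟶ E}
    {g' : B ⟶ F} (p : CellPath J f g K) (ψ : Cell K h k L) (hf : f ≫ h = f') (hg : g ≫ k = g') :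
    compTo (p.append (vidPath g) (HPath.append_nil J).symm (HPath.append_nil K).symm) ψ hf hg =
      compTo p ψ hf hg :=
  congrArg _ (comp_insert_right p ψ)

/-- `(η ⊙ ζ) ∘ (p ⌢ q) = (η ∘ p) ⊙ (ζ ∘ q)` -/
theorem compTo_hcomp {A B C D E F M : Ob} {J : HPath (Hor (Ob := Ob)) A B} {f : A ⟶ C}
    {g : B ⟶ D} {K : HPath Hor C D} {J' : HPath Hor B E} {g' : E ⟶ F} {K' : HPath Hor D F}
    {J'' : HPath Hor A E} {K'' : HPath Hor C F} (p : CellPath J f g K) (q : CellPath J' g g' K')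
    {d : C ⟶ M} {l : D ⟶ M} {k : F ⟶ M} (η : Cell K d l (.empty M)) (ζ : Cell K' l k (.empty M))
    (hJ : J'' = J.append J') (hK : K'' = K.append K') {a : A ⟶ M} {b : B ⟶ M} {c : E ⟶ M}
    (ha : f ≫ d = a) (hb : g ≫ l = b) (hc : g' ≫ k = c) :
    compTo (p.append q hJ hK) (hcomp η ζ hK) ha hc =
      hcomp (compTo p η ha hb) (compTo q ζ hb hc) hJ := by
  subst ha hb hc
  exact (compTo_rows (.cons p η (.single q ζ rfl) hJ hK rfl) (vid (𝟙 M)) rfl rfl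
    (Category.comp_id d) (Category.comp_id k) (Category.comp_id _) (Category.comp_id _) rfl
    rfl).symm

/-- By interchange, both bracketings equal the composite of `id_M ⊙ id_M` with the path `(α, β, γ)`.
-/
theorem hcomp_assoc {A B E F M : Ob} {J : HPath (Hor (Ob := Ob)) A B} {H : HPath Hor B E}
    {G : HPath Hor E F} {J₁ : HPath Hor A E} {J₂ : HPath Hor B F} {J' : HPath Hor A F}
    {a : A ⟶ M} {b : B ⟶ M} {c : E ⟶ M} {d : F ⟶ M} (α : Cell J a b (.empty M))
    (β : Cell H b c (.empty M)) (γ : Cell G c d (.empty M)) (h₁ : J₁ = J.append H)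
    (h₂ : J' = J₁.append G) (h₃ : J₂ = H.append G) (h₄ : J' = J.append J₂) :
    hcomp (hcomp α β h₁) γ h₂ = hcomp α (hcomp β γ h₃) h₄ := by
  subst h₁ h₃
  have e₁ := compTo_hcomp ((CellPath.of α).append (CellPath.of β) rfl rfl) (CellPath.of γ)
    (vid (𝟙 M)) (vid (𝟙 M)) h₂ rfl (Category.comp_id a) (Category.comp_id c) (Category.comp_id d)
  have e₂ := compTo_hcomp (CellPath.of α) ((CellPath.of β).append (CellPath.of γ) rfl rfl)
    (vid (𝟙 M)) (vid (𝟙 M)) h₄ rfl (Category.comp_id a) (Category.comp_id b) (Category.comp_id d)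
  have e₃ := compTo_vid γ (Category.comp_id c) (Category.comp_id d)
  have e₄ := compTo_vid α (Category.comp_id a) (Category.comp_id b)
  exact (congrArg (fun z => hcomp (hcomp α β rfl) z h₂) e₃.symm).trans
    (e₁.symm.trans (e₂.trans (congrArg (fun z => hcomp z (hcomp β γ rfl) h₄) e₄)))

theorem hcomp_vid {A B M : Ob} {J : HPath (Hor (Ob := Ob)) A B} {d : A ⟶ M} {l : B ⟶ M}
    (η : Cell J d l (.empty M)) (hJ : J = J.append (.nil B)) : hcomp η (vid l) hJ = η :=
  (compTo_insert_right (CellPath.of η) (vid (𝟙 M)) (Category.comp_id d) (Category.comp_id l)).trans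
    (vid_comp η)

/-- The vertical cell `θ` is invertible. -/
def IsVertIso {B M : Ob} {l l' : B ⟶ M}
    (θ : Cell (.nil B : HPath (Hor (Ob := Ob)) B B) l l' (.empty M)) : Prop :=
  ∃ θ' : Cell (.nil B : HPath (Hor (Ob := Ob)) B B) l' l (.empty M),
    hcomp θ θ' rfl = vid l ∧ hcomp θ' θ rfl = vid l'

theorem compTo_vidPath_vid {A B M : Ob} (k : A ⟶ B) {l : B ⟶ M} {a : A ⟶ M} (h : k ≫ l = a) :
    compTo (Ob := Ob) (vidPath k) (vid l) h h = vid a := by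
  subst h
  exact vid_comp_vid k l

theorem IsVertIso.precomp {A B M : Ob} {l l' : B ⟶ M}
    {θ : Cell (.nil B : HPath (Hor (Ob := Ob)) B B) l l' (.empty M)} (hθ : IsVertIso θ)
    (k : A ⟶ B) {a a' : A ⟶ M} (ha : k ≫ l = a) (ha' : k ≫ l' = a') :
    IsVertIso (compTo (vidPath k) θ ha ha') := by
  obtain ⟨θ', h₁, h₂⟩ := hθ
  refine ⟨compTo (vidPath k) θ' ha' ha, ?_, ?_⟩
  · have e := compTo_hcomp (vidPath k) (vidPath k) θ θ' rfl rfl ha ha' ha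
    rw [← e, h₁]
    exact (compTo_insert_right _ _ _ _).trans (compTo_vidPath_vid k ha)
  · have e := compTo_hcomp (vidPath k) (vidPath k) θ' θ rfl rfl ha' ha ha'
    rw [← e, h₂]
    exact (compTo_insert_right _ _ _ _).trans (compTo_vidPath_vid k ha')

theorem IsVertIso.hcomp_right_bijective {A B M : Ob} {l l' : B ⟶ M}
    {θ : Cell (.nil B : HPath (Hor (Ob := Ob)) B B) l l' (.empty M)} (hθ : IsVertIso θ)
    (H : HPath Hor A B) (k : A ⟶ M) (hH : H = H.append (.nil B)) :
    Function.Bijective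
      (fun ζ : Cell H k l (.empty M) => (hcomp ζ θ hH : Cell H k l' (.empty M))) := by
  obtain ⟨θ', h₁, h₂⟩ := hθ
  refine Function.bijective_iff_has_inverse.2 ⟨fun ζ => hcomp ζ θ' hH, fun ζ => ?_, fun ζ => ?_⟩
  · exact (hcomp_assoc ζ θ θ' hH hH rfl hH).trans
      ((congrArg (fun z => hcomp ζ z hH) h₁).trans (hcomp_vid ζ hH))
  · exact (hcomp_assoc ζ θ' θ hH hH rfl hH).trans
      ((congrArg (fun z => hcomp ζ z hH) h₂).trans (hcomp_vid ζ hH))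

/-- The paths that are to be considered in the definition of (weakly) left Kan cells. -/
def Strength.Allows {H : Ob → Ob → Type w} {A B : Ob} (s : Strength) (p : HPath H A B) : Prop :=
  match s with
  | .plain => True
  | .weak => p.length = 0

theorem Strength.allows_nil (s : Strength) (A : Ob) :
    s.Allows (.nil A : HPath (Hor (Ob := Ob)) A A) := by
  cases s
  · trivial
  · rfl

/-- Treats both strengths at once. The free path `J'` absorbs the equality `J.append (.nil B) = J`,
which is not definitional. -/
theorem isKan_iff {s : Strength} {A B M : Ob} {J : HPath (Hor (Ob := Ob)) A B} {d : A ⟶ M}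
    {l : B ⟶ M} {η : Cell J d l (.empty M)} :
    IsKan s η ↔ ∀ ⦃E : Ob⦄ (H : HPath Hor B E), s.Allows H → ∀ ⦃J' : HPath Hor A E⦄
      (hJ : J' = J.append H) (k : E ⟶ M),
      Function.Bijective (fun ζ : Cell H l k (.empty M) => hcomp η ζ hJ) := by
  simp only [Function.bijective_iff_existsUnique]
  cases s
  · constructor
    · rintro h E H - _ rfl k φ
      exact h H k φ
    · intro h E H k φ
      exact h H trivial rfl k φ
  · constructor
    · intro h E H hH J' hJ k φ
      cases H with
      | nil =>
        obtain rfl : J' = J := hJ.trans (HPath.append_nil J)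
        exact h k φ
      | cons K p => exact absurd hH (Nat.succ_ne_zero _)
    · intro h k φ
      exact h (.nil B) rfl (HPath.append_nil J).symm k φ

/-- Uniqueness of Kan extensions: the two comparison cells are mutually inverse by unique
factorization. Only the empty path `H` is needed, so weak Kan cells suffice. -/
theorem IsKan.exists_vertIso {s : Strength} {A B M : Ob} {J : HPath (Hor (Ob := Ob)) A B}
    {d : A ⟶ M} {l l' : B ⟶ M} {η : Cell J d l (.empty M)} {ε : Cell J d l' (.empty M)}
    (hη : IsKan s η) (hε : IsKan s ε) :
    ∃ θ : Cell (.nil B) l l' (.empty M),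
      IsVertIso θ ∧ hcomp η θ (HPath.append_nil J).symm = ε := by
  have bη := isKan_iff.1 hη (.nil B) (s.allows_nil B) (HPath.append_nil J).symm
  have bε := isKan_iff.1 hε (.nil B) (s.allows_nil B) (HPath.append_nil J).symm
  obtain ⟨θ, hθ⟩ := (bη l').2 ε
  obtain ⟨θ', hθ'⟩ := (bε l).2 η
  refine ⟨θ, ⟨θ', (bη l).1 ?_, (bε l').1 ?_⟩, hθ⟩
  · exact (hcomp_assoc η θ θ' _ (HPath.append_nil J).symm _ _).symm.trans
      ((congrArg (fun z => hcomp z θ' _) hθ).trans (hθ'.trans (hcomp_vid η _).symm))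
  · exact (hcomp_assoc ε θ' θ _ (HPath.append_nil J).symm _ _).symm.trans
      ((congrArg (fun z => hcomp z θ _) hθ').trans (hθ.trans (hcomp_vid ε _).symm))

theorem isKan_castCell {s : Strength} {A B M : Ob} {J : HPath (Hor (Ob := Ob)) A B} {d d' : A ⟶ M}
    {l l' : B ⟶ M} {η : Cell J d l (.empty M)} (hd : d = d') (hl : l = l') :
    IsKan s (castCell hd hl η) ↔ IsKan s η := by
  subst hd hl
  rfl

theorem isCartesian_iff {A B C D : Ob} {J : Target (Hor (Ob := Ob)) A B} {f : A ⟶ C} {g : B ⟶ D}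
    {K : Target Hor C D} {ψ : Cell J.toPath f g K} :
    IsCartesian ψ ↔ ∀ ⦃X Y : Ob⦄ (h : X ⟶ A) (k : Y ⟶ B) (H : HPath Hor X Y) (f' : X ⟶ C)
      (g' : Y ⟶ D) (hf : h ≫ f = f') (hg : k ≫ g = g'),
      Function.Bijective (fun χ : Cell H h k J => compTo (.of χ) ψ hf hg) := by
  constructor
  · rintro h X Y a b H _ _ rfl rfl
    exact (Function.bijective_iff_existsUnique _).2 (h a b H)
  · intro h X Y a b H
    exact (Function.bijective_iff_existsUnique _).1 (h a b H _ _ rfl rfl)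

theorem compTo_of_hcomp_vert {A B C D M : Ob} {J : HPath (Hor (Ob := Ob)) A B} {f : A ⟶ C}
    {g : B ⟶ D} {K : HPath Hor C D} (p : CellPath J f g K) {d : C ⟶ M} {l l' : D ⟶ M}
    (η : Cell K d l (.empty M)) (θ : Cell (.nil D) l l' (.empty M)) {a : A ⟶ M} {b b' : B ⟶ M}
    (ha : f ≫ d = a) (hb : g ≫ l = b) (hb' : g ≫ l' = b') :
    compTo p (hcomp η θ (HPath.append_nil K).symm) ha hb' =
      hcomp (compTo p η ha hb) (compTo (vidPath g) θ hb hb') (HPath.append_nil J).symm :=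
  (compTo_insert_right p _ _ _).symm.trans
    (compTo_hcomp p (vidPath g) η θ (HPath.append_nil J).symm (HPath.append_nil K).symm ha hb hb')

/-- Composing with `ε ⊙ θ` is composing with `ε` and then pasting `θ ∘ id_k` on the right, and both
are bijective. -/
theorem IsCartesian.hcomp_vertIso {A B M : Ob} {J : Target (Hor (Ob := Ob)) A B} {f : A ⟶ M}
    {l l' : B ⟶ M} {ε : Cell J.toPath f l (.empty M)} (hε : IsCartesian ε)
    {θ : Cell (.nil B) l l' (.empty M)} (hθ : IsVertIso θ) :
    IsCartesian (J := J) (hcomp ε θ (HPath.append_nil _).symm) := by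
  rw [isCartesian_iff]
  rintro X Y h k H _ _ rfl rfl
  have e : (fun χ : Cell H h k J =>
      compTo (.of χ) (hcomp ε θ (HPath.append_nil _).symm) rfl rfl) =
      (fun ζ => hcomp ζ (compTo (vidPath k) θ rfl rfl) (HPath.append_nil H).symm) ∘
        fun χ : Cell H h k J => compTo (.of χ) ε rfl rfl :=
    funext fun χ => compTo_of_hcomp_vert (.of χ) ε θ rfl rfl rfl
  rw [e]
  exact ((hθ.precomp k rfl rfl).hcomp_right_bijective H _ _).comp
    (isCartesian_iff.1 hε h k H _ _ rfl rfl)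

theorem compTo_of_comp_eq {A B C D E F X Y : Ob} {J : Target (Hor (Ob := Ob)) A B} {f : A ⟶ C}
    {g : B ⟶ D} {K : Target Hor C D} {h : C ⟶ E} {k : D ⟶ F} {L : Target Hor E F}
    (ψ : Cell J.toPath f g K) (χ : Cell K.toPath h k L) {a : A ⟶ E} {b : B ⟶ F} (ha : f ≫ h = a)
    (hb : g ≫ k = b) {m : X ⟶ A} {n : Y ⟶ B} {H : HPath Hor X Y} {a' : X ⟶ E} {b' : Y ⟶ F}
    (ha' : m ≫ a = a') (hb' : n ≫ b = b') :
    (fun ζ : Cell H m n J => compTo (.of ζ) (compTo (.of ψ) χ ha hb) ha' hb') =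
      (fun ζ : Cell H (m ≫ f) (n ≫ g) K => compTo (.of ζ) χ
        ((Category.assoc _ _ _).trans (by rw [ha, ha'] : m ≫ f ≫ h = a'))
        ((Category.assoc _ _ _).trans (by rw [hb, hb'] : n ≫ g ≫ k = b'))) ∘
        fun ζ : Cell H m n J => compTo (.of ζ) ψ rfl rfl :=
  funext fun ζ => (compTo_assoc (.of ζ) ψ χ rfl rfl ha hb _ _ ha' hb').symm

theorem IsCartesian.comp {A B C D E F : Ob} {J : Target (Hor (Ob := Ob)) A B} {f : A ⟶ C}
    {g : B ⟶ D} {K : Target Hor C D} {h : C ⟶ E} {k : D ⟶ F} {L : Target Hor E F}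
    {ψ : Cell J.toPath f g K} {χ : Cell K.toPath h k L} (hψ : IsCartesian ψ) (hχ : IsCartesian χ)
    {a : A ⟶ E} {b : B ⟶ F} (ha : f ≫ h = a) (hb : g ≫ k = b) :
    IsCartesian (compTo (.of ψ) χ ha hb) := by
  rw [isCartesian_iff]
  intro X Y m n H a' b' ha' hb'
  rw [compTo_of_comp_eq]
  exact (isCartesian_iff.1 hχ _ _ _ _ _ _ _).comp (isCartesian_iff.1 hψ _ _ _ _ _ _ _)

theorem IsCartesian.of_comp {A B C D E F : Ob} {J : Target (Hor (Ob := Ob)) A B} {f : A ⟶ C}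
    {g : B ⟶ D} {K : Target Hor C D} {h : C ⟶ E} {k : D ⟶ F} {L : Target Hor E F}
    {ψ : Cell J.toPath f g K} {χ : Cell K.toPath h k L} {a : A ⟶ E} {b : B ⟶ F}
    {ha : f ≫ h = a} {hb : g ≫ k = b} (hc : IsCartesian (compTo (.of ψ) χ ha hb))
    (hχ : IsCartesian χ) : IsCartesian ψ := by
  rw [isCartesian_iff]
  rintro X Y m n H _ _ rfl rfl
  have e := isCartesian_iff.1 hc m n H _ _ rfl rfl
  rw [compTo_of_comp_eq] at e
  exact (Function.Bijective.of_comp_iff' (isCartesian_iff.1 hχ _ _ _ _ _ _ _) _).1 e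

/-- The horizontal cell `σ` is invertible. -/
def IsHorIso {A B : Ob} {J K : Hor (Ob := Ob) A B}
    (σ : Cell (.cons J (.nil B)) (𝟙 A) (𝟙 B) (.single K)) : Prop :=
  ∃ τ : Cell (.cons K (.nil B)) (𝟙 A) (𝟙 B) (.single J),
    compTo (.of σ) τ (Category.comp_id _) (Category.comp_id _) = hid J ∧
      compTo (.of τ) σ (Category.comp_id _) (Category.comp_id _) = hid K

theorem IsHorIso.isCartesian {A B : Ob} {J K : Hor (Ob := Ob) A B}
    {σ : Cell (.cons J (.nil B)) (𝟙 A) (𝟙 B) (.single K)} (hσ : IsHorIso σ) :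
    IsRestriction σ := by
  obtain ⟨τ, h₁, h₂⟩ := hσ
  refine isCartesian_iff.2 ?_
  intro X Y h k H f' g' hf hg
  obtain rfl : h = f' := (Category.comp_id h).symm.trans hf
  obtain rfl : k = g' := (Category.comp_id k).symm.trans hg
  refine Function.bijective_iff_has_inverse.2 ⟨fun ζ => compTo (.of ζ) τ hf hg, fun ζ => ?_,
    fun ζ => ?_⟩
  · exact (compTo_assoc (.of ζ) σ τ hf hg (Category.comp_id _) (Category.comp_id _) hf hg hf
      hg).trans ((congrArg (fun z => compTo (.of ζ) z hf hg) h₁).trans (compTo_hid ζ hf hg))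
  · exact (compTo_assoc (.of ζ) τ σ hf hg (Category.comp_id _) (Category.comp_id _) hf hg hf
      hg).trans ((congrArg (fun z => compTo (.of ζ) z hf hg) h₂).trans (compTo_hid ζ hf hg))

/-- Factoring `hid K` through `σ` gives a right inverse; uniqueness of factorizations makes it
two-sided. -/
theorem IsCartesian.isHorIso {A B : Ob} {J K : Hor (Ob := Ob) A B}
    {σ : Cell (.cons J (.nil B)) (𝟙 A) (𝟙 B) (.single K)} (hσ : IsRestriction σ) :
    IsHorIso σ := by
  have b := isCartesian_iff.1 hσ
  have hA := Category.comp_id (𝟙 A)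
  have hB := Category.comp_id (𝟙 B)
  obtain ⟨τ, hτ⟩ := (b (𝟙 A) (𝟙 B) _ _ _ hA hB).2 (hid K)
  refine ⟨τ, (b (𝟙 A) (𝟙 B) _ _ _ hA hB).1 ?_, hτ⟩
  exact (compTo_assoc (.of σ) τ σ hA hB hA hB hA hB hA hB).trans
    ((congrArg (fun z => compTo (.of σ) z hA hB) hτ).trans
      ((compTo_hid σ hA hB).trans (hid_compTo σ hA hB).symm))

theorem isRestriction_hid {A B : Ob} (K : Hor (Ob := Ob) A B) : IsRestriction (hid K) :=
  IsHorIso.isCartesian ⟨hid K, compTo_hid _ _ _, compTo_hid _ _ _⟩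

end Kan

/-! ### Cocartesian cells and the criterion for Kan composites -/

section Cocartesian

variable {Ob : Type u} [Category.{v} Ob] [AugmentedVirtualDoubleCategory.{u, v, w, x} Ob]

open AugmentedVirtualDoubleCategory

/-- Composition with `p` is a bijection on cells with vertical morphisms `h` and `k` and horizontal
target `L`. -/
def CocartesianAt {A B C D X Y : Ob} {J : HPath (Hor (Ob := Ob)) A B} {f : A ⟶ C} {g : B ⟶ D}
    {K : HPath Hor C D} (p : CellPath J f g K) (h : C ⟶ X) (k : D ⟶ Y) (L : Target Hor X Y) :
    Prop :=
  Function.Bijective (fun χ : Cell K h k L => comp p χ)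

theorem isWeaklyCocartesian_iff {t : Arity} {A B C D : Ob} {J : HPath (Hor (Ob := Ob)) A B}
    {f : A ⟶ C} {g : B ⟶ D} {K : HPath Hor C D} {p : CellPath J f g K} :
    IsWeaklyCocartesian t p ↔ ∀ ⦃X Y : Ob⦄ (h : C ⟶ X) (k : D ⟶ Y) (L : Target Hor X Y),
      L.HasArity t → CocartesianAt p h k L := by
  simp only [CocartesianAt, Function.bijective_iff_existsUnique]
  rfl

theorem CocartesianAt.compTo_bijective {A B C D X Y : Ob} {J : HPath (Hor (Ob := Ob)) A B}
    {f : A ⟶ C} {g : B ⟶ D} {K : HPath Hor C D} {p : CellPath J f g K} {h : C ⟶ X} {k : D ⟶ Y}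
    {L : Target Hor X Y} (hp : CocartesianAt p h k L) {a : A ⟶ X} {b : B ⟶ Y} (ha : f ≫ h = a)
    (hb : g ≫ k = b) : Function.Bijective (fun χ : Cell K h k L => compTo p χ ha hb) :=
  (castCell_bijective ha hb).comp hp

theorem IsWeaklyCocartesian.congr {t : Arity} {A B C D : Ob} {J : HPath (Hor (Ob := Ob)) A B}
    {f : A ⟶ C} {g : B ⟶ D} {K : HPath Hor C D} {p q : CellPath J f g K}
    (hp : IsWeaklyCocartesian t p)
    (e : ∀ ⦃X Y : Ob⦄ (h : C ⟶ X) (k : D ⟶ Y) (L : Target Hor X Y) (χ : Cell K h k L),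
      comp p χ = comp q χ) : IsWeaklyCocartesian t q := by
  intro X Y h k L hL χ
  simpa only [e] using hp h k L hL χ

/-- The path `(φ, id_{H₁}, …, id_{Hₙ})`. -/
def whisker {A B C E : Ob} {J : HPath (Hor (Ob := Ob)) A B} {f : A ⟶ C} {K : Hor C B}
    (φ : Cell J f (𝟙 B) (.single K)) (H : HPath Hor B E) {J' : HPath Hor A E}
    (hJ : J' = J.append H) : CellPath J' f (𝟙 E) (.cons K H) :=
  .cons φ (ids H) hJ rfl

/-- The path `(φ, c, id_{H₁}, …, id_{Hₙ})`. -/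
def whiskerCons {A B C Y E : Ob} {J : HPath (Hor (Ob := Ob)) A B} {f : A ⟶ C} {K : Hor C B}
    (φ : Cell J f (𝟙 B) (.single K)) {K₁ K₂ : Hor B Y}
    (c : Cell (.cons K₁ (.nil Y)) (𝟙 B) (𝟙 Y) (.single K₂)) (H : HPath Hor Y E)
    {J' : HPath Hor A E} (hJ : J' = J.append (.cons K₁ H)) :
    CellPath J' f (𝟙 E) (.cons K (.cons K₂ H)) :=
  .cons φ (.cons c (ids H) rfl rfl) hJ rfl

theorem comp_whisker_nil {A B C X Y : Ob} {J : HPath (Hor (Ob := Ob)) A B} {f : A ⟶ C}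
    {K : Hor C B} (φ : Cell J f (𝟙 B) (.single K)) (hJ : J = J.append (.nil B)) {h : C ⟶ X}
    {k : B ⟶ Y} {L : Target Hor X Y} (χ : Cell (.cons K (.nil B)) h k L) :
    comp (whisker φ (.nil B) hJ) χ = comp (.of φ) χ :=
  comp_insert_right (.of φ) χ

/-- The two paths differ only for empty `H`, when `whiskerCons` ends in a vertical identity, which
composition ignores. -/
theorem comp_whisker_cons {A B C Y E X Z : Ob} {J : HPath (Hor (Ob := Ob)) A B} {f : A ⟶ C}
    {K : Hor C B} (φ : Cell J f (𝟙 B) (.single K)) (K₁ : Hor B Y) : (H : HPath Hor Y E) →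
    {J' : HPath Hor A E} → (hJ : J' = J.append (.cons K₁ H)) → {h : C ⟶ X} →
    {k : E ⟶ Z} → {L : Target Hor X Z} → (χ : Cell (.cons K (.cons K₁ H)) h k L) →
    comp (whisker φ (.cons K₁ H) hJ) χ = comp (whiskerCons φ (hid K₁) H hJ) χ
  | .nil _, _, hJ, _, _, _, χ =>
      (comp_insert_right (CellPath.cons φ (.single (hid K₁) rfl) hJ rfl) χ).symm
  | .cons _ _, _, _, _, _, _, _ => rfl

theorem compTo_whisker_hid {A B E X Z : Ob} (K : Hor (Ob := Ob) A B) :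
    (H : HPath Hor B E) → {h : A ⟶ X} → {k : E ⟶ Z} → {L : Target Hor X Z} →
    (χ : Cell (.cons K H) h k L) → (hh : 𝟙 A ≫ h = h) → (hk : 𝟙 E ≫ k = k) →
    compTo (whisker (hid K) H rfl) χ hh hk = χ
  | .nil _, _, _, _, χ, hh, hk =>
      (congrArg (castCell hh hk) (comp_insert_right (CellPath.of (hid K)) χ)).trans (comp_ids χ)
  | .cons _ _, _, _, _, χ, _, _ => comp_ids χ

theorem compTo_whisker {A B C E F X Z : Ob} {J : HPath (Hor (Ob := Ob)) A B} {f : A ⟶ C}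
    {K : Hor C B} (φ : Cell J f (𝟙 B) (.single K)) {h : C ⟶ F} {L : Hor F B}
    (ψ : Cell (.cons K (.nil B)) h (𝟙 B) (.single L)) (H : HPath Hor B E) {J' : HPath Hor A E}
    (hJ : J' = J.append H) {l : F ⟶ X} {m : E ⟶ Z} {N : Target Hor X Z}
    (χ : Cell (.cons L H) l m N) {a : A ⟶ F} (ha : f ≫ h = a) (hB : 𝟙 B ≫ 𝟙 B = 𝟙 B)
    {a' : C ⟶ X} (ha' : h ≫ l = a') {a'' : A ⟶ X} (e₁ : a ≫ l = a'') (hm : 𝟙 E ≫ m = m)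
    (e₂ : f ≫ a' = a'') :
    compTo (whisker (compTo (.of φ) ψ ha hB) H hJ) χ e₁ hm =
      compTo (whisker φ H hJ) (compTo (whisker ψ H rfl) χ ha' hm) e₂ hm :=
  compTo_cons φ ψ (idRows H) hJ rfl rfl χ ha hB (Category.comp_id _) ha' hm e₁ hm e₂ hm
    (idRows_top H) (idRows_bot H) (idRows_composites H)

theorem compTo_whiskerCons {A B C Y E X Z : Ob} {J : HPath (Hor (Ob := Ob)) A B} {f : A ⟶ C}
    {K L : Hor C B} (φ : Cell J f (𝟙 B) (.single K))
    (ψ : Cell (.cons K (.nil B)) (𝟙 C) (𝟙 B) (.single L)) {K₁ K₂ K₃ : Hor B Y}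
    (c : Cell (.cons K₁ (.nil Y)) (𝟙 B) (𝟙 Y) (.single K₂))
    (d : Cell (.cons K₂ (.nil Y)) (𝟙 B) (𝟙 Y) (.single K₃)) (H : HPath Hor Y E)
    {J' : HPath Hor A E} (hJ : J' = J.append (.cons K₁ H)) {l : C ⟶ X} {m : E ⟶ Z}
    {N : Target Hor X Z} (χ : Cell (.cons L (.cons K₃ H)) l m N) (hf : f ≫ 𝟙 C = f)
    (hB : 𝟙 B ≫ 𝟙 B = 𝟙 B) (hY : 𝟙 Y ≫ 𝟙 Y = 𝟙 Y) {a : A ⟶ X} (hl : 𝟙 C ≫ l = l)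
    (hm : 𝟙 E ≫ m = m) (ha : f ≫ l = a) :
    compTo (whiskerCons (compTo (.of φ) ψ hf hB) (compTo (.of c) d hB hY) H hJ) χ ha hm =
      compTo (whiskerCons φ c H hJ) (compTo (whiskerCons ψ d H rfl) χ hl hm) ha hm :=
  compTo_cons φ ψ (.cons (.of c) d (idRows H) rfl rfl rfl) hJ rfl rfl χ hf hB
    (Category.comp_id _) hl hm ha hm ha hm
    (congrArg (fun p => CellPath.cons c p rfl rfl) (idRows_top H))
    (congrArg (fun p => CellPath.cons d p rfl rfl) (idRows_bot H))
    ((castPath_cons (K := .single K₃) hB hY (Category.comp_id _) (comp (.of c) d)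
      (idRows H).composites rfl rfl).trans
      (congrArg (fun p => CellPath.cons (compTo (.of c) d hB hY) p rfl rfl)
        (idRows_composites H)))

theorem compTo_whiskerCons_hid {A B Y E X Z : Ob} (K : Hor (Ob := Ob) A B) (K₁ : Hor B Y)
    (H : HPath Hor Y E) {h : A ⟶ X} {k : E ⟶ Z} {L : Target Hor X Z}
    (χ : Cell (.cons K (.cons K₁ H)) h k L) (hh : 𝟙 A ≫ h = h) (hk : 𝟙 E ≫ k = k) :
    compTo (whiskerCons (hid K) (hid K₁) H rfl) χ hh hk = χ :=
  (congrArg (castCell hh hk) (comp_whisker_cons (hid K) K₁ H rfl χ).symm).trans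
    (compTo_whisker_hid K _ χ hh hk)

theorem IsHorIso.whiskerCons_bijective {B C Y E X Z : Ob} (K : Hor (Ob := Ob) C B)
    {K₁ K₂ : Hor B Y} {c : Cell (.cons K₁ (.nil Y)) (𝟙 B) (𝟙 Y) (.single K₂)} (hc : IsHorIso c)
    (H : HPath Hor Y E) (h : C ⟶ X) (k : E ⟶ Z) (L : Target Hor X Z) (hh : 𝟙 C ≫ h = h)
    (hk : 𝟙 E ≫ k = k) :
    Function.Bijective (fun χ : Cell (.cons K (.cons K₂ H)) h k L =>
      compTo (whiskerCons (hid K) c H rfl) χ hh hk) := by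
  obtain ⟨d, h₁, h₂⟩ := hc
  have hid₂ := compTo_hid (hid K) (Category.comp_id _) (Category.comp_id _)
  refine Function.bijective_iff_has_inverse.2
    ⟨fun χ => compTo (whiskerCons (hid K) d H rfl) χ hh hk, fun χ => ?_, fun χ => ?_⟩
  · have e := compTo_whiskerCons (hid K) (hid K) d c H rfl χ (Category.comp_id _)
      (Category.comp_id _) (Category.comp_id _) hh hk hh
    exact e.symm.trans ((congrArg₂ (fun z z' => compTo (whiskerCons z z' H rfl) χ hh hk)
      hid₂ h₂).trans (compTo_whiskerCons_hid K K₂ H χ hh hk))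
  · have e := compTo_whiskerCons (hid K) (hid K) c d H rfl χ (Category.comp_id _)
      (Category.comp_id _) (Category.comp_id _) hh hk hh
    exact e.symm.trans ((congrArg₂ (fun z z' => compTo (whiskerCons z z' H rfl) χ hh hk)
      hid₂ h₁).trans (compTo_whiskerCons_hid K K₁ H χ hh hk))

theorem IsHorIso.whisker_bijective {B C E X Z : Ob} {K L : Hor (Ob := Ob) C B}
    {σ : Cell (.cons K (.nil B)) (𝟙 C) (𝟙 B) (.single L)} (hσ : IsHorIso σ)
    (H : HPath Hor B E) (h : C ⟶ X) (k : E ⟶ Z) (N : Target Hor X Z) (hh : 𝟙 C ≫ h = h)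
    (hk : 𝟙 E ≫ k = k) :
    Function.Bijective (fun χ : Cell (.cons L H) h k N =>
      compTo (whisker σ H rfl) χ hh hk) := by
  obtain ⟨τ, h₁, h₂⟩ := hσ
  refine Function.bijective_iff_has_inverse.2
    ⟨fun χ => compTo (whisker τ H rfl) χ hh hk, fun χ => ?_, fun χ => ?_⟩
  · have e := compTo_whisker τ σ H rfl χ (Category.comp_id _) (Category.comp_id _) hh hh hk hh
    exact e.symm.trans ((congrArg (fun z => compTo (whisker z H rfl) χ hh hk) h₂).trans
      (compTo_whisker_hid L H χ hh hk))
  · have e := compTo_whisker σ τ H rfl χ (Category.comp_id _) (Category.comp_id _) hh hh hk hh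
    exact e.symm.trans ((congrArg (fun z => compTo (whisker z H rfl) χ hh hk) h₁).trans
      (compTo_whisker_hid K H χ hh hk))

/-- The vertical target is trivial, so the cells defining `K₁(id, id)` are invertible, and in the
definition of right cocartesian they may be replaced by horizontal identities. The outcome has the
same shape as `isKan_iff`. -/
theorem isCocartesian_iff {s : Strength} {t : Arity} {A B C : Ob}
    {J : HPath (Hor (Ob := Ob)) A B} {f : A ⟶ C} {K : Hor C B}
    {φ : Cell J f (𝟙 B) (.single K)} :
    IsCocartesian s t (CellPath.of φ) ↔ ∀ ⦃E : Ob⦄ (H : HPath Hor B E), s.Allows H →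
      ∀ ⦃J' : HPath Hor A E⦄ (hJ : J' = J.append H),
        IsWeaklyCocartesian t (whisker φ H hJ) := by
  have nil_mp : IsWeaklyCocartesian t (CellPath.of φ) → ∀ ⦃J' : HPath Hor A B⦄
      (hJ : J' = J.append (.nil B)), IsWeaklyCocartesian t (whisker φ (.nil B) hJ) := by
    intro h J' hJ
    obtain rfl : J' = J := hJ.trans (HPath.append_nil J)
    exact h.congr fun X Y h k L χ => (comp_whisker_nil φ hJ χ).symm
  have nil_mpr : IsWeaklyCocartesian t (whisker φ (.nil B) (HPath.append_nil J).symm) →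
      IsWeaklyCocartesian t (CellPath.of φ) :=
    fun h => h.congr fun X Y h k L χ => comp_whisker_nil φ _ χ
  cases s
  · constructor
    · rintro ⟨h₀, h₁⟩ E H - J' hJ
      cases H with
      | nil => exact nil_mp h₀ hJ
      | cons K₁ Ks =>
        subst hJ
        exact (h₁ K₁ Ks K₁ (hid K₁) (isRestriction_hid K₁)).congr
          fun X Y h k L χ => (comp_whisker_cons φ K₁ Ks rfl χ).symm
    · intro h
      refine ⟨nil_mpr (h (.nil B) trivial _), ?_⟩
      intro Y₁ Y K₁ Ks K₁' c hc
      refine isWeaklyCocartesian_iff.2 ?_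
      intro X Z a b L hL
      have b₁ := isWeaklyCocartesian_iff.1 (h (.cons K₁' Ks) trivial rfl) a b L hL
      have b₂ := (IsCartesian.isHorIso hc).whiskerCons_bijective K Ks a b L (Category.id_comp a)
        (Category.id_comp b)
      -- The path `(φ, c, id, …)` is `(φ, id, id, …)` followed by `(id, c, id, …)`, and the latter
      -- acts bijectively because `c` is invertible.
      have e : (fun χ : Cell (.cons K (.cons K₁ Ks)) a b L =>
          compTo (whiskerCons φ c Ks rfl) χ rfl (Category.id_comp b)) =
          (fun χ => compTo (whisker φ (.cons K₁' Ks) rfl) χ rfl (Category.id_comp b)) ∘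
            fun χ => compTo (whiskerCons (hid K) c Ks rfl) χ (Category.id_comp a)
              (Category.id_comp b) := by
        funext χ
        have e₁ := compTo_whiskerCons φ (hid K) (hid K₁') c Ks rfl χ (Category.comp_id f)
          (Category.comp_id _) (Category.comp_id _) (Category.id_comp a) (Category.id_comp b) rfl
        have e₂ := compTo_hid φ (Category.comp_id _) (Category.comp_id _)
        have e₃ := hid_compTo c (Category.comp_id _) (Category.comp_id _)
        refine ((congrArg₂ (fun z z' => compTo (whiskerCons z z' Ks rfl) χ rfl
          (Category.id_comp b)) e₂ e₃).symm.trans e₁).trans ?_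
        exact congrArg (castCell _ _) (comp_whisker_cons φ K₁' Ks rfl _).symm
      have b₃ := (b₁.compTo_bijective rfl (Category.id_comp b)).comp b₂
      exact (Function.Bijective.of_comp_iff' (castCell_bijective rfl (Category.id_comp b)) _).1
        ((iff_of_eq (congrArg _ e)).2 b₃)
  · constructor
    · intro h E H hH J' hJ
      cases H with
      | nil => exact nil_mp h hJ
      | cons K₁ Ks => exact absurd hH (Nat.succ_ne_zero _)
    · intro h
      exact nil_mpr (h (.nil B) rfl _)

/-- Composition with `p` below commutes with composition with `c` above, and the latter is bijective
on both sides of the square. This is the device for trading unary and nullary targets. -/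
theorem cocartesianAt_cartesian_iff {A B C D X Y X' Y' : Ob} {J : HPath (Hor (Ob := Ob)) A B}
    {f : A ⟶ C} {g : B ⟶ D} {K : HPath Hor C D} (p : CellPath J f g K) {h : C ⟶ X} {k : D ⟶ Y}
    {a : X ⟶ X'} {b : Y ⟶ Y'} {L : Target Hor X Y} {L' : Target Hor X' Y'}
    {c : Cell L.toPath a b L'} (hc : IsCartesian c) {h' : C ⟶ X'} {k' : D ⟶ Y'} (hh : h ≫ a = h')
    (hk : k ≫ b = k') : CocartesianAt p h k L ↔ CocartesianAt p h' k' L' := by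
  subst hh hk
  have b₁ := isCartesian_iff.1 hc h k K _ _ rfl rfl
  have b₂ := isCartesian_iff.1 hc (f ≫ h) (g ≫ k) J _ _ (Category.assoc _ _ _)
    (Category.assoc _ _ _)
  have e : (fun χ : Cell J (f ≫ h) (g ≫ k) L => compTo (.of χ) c (Category.assoc _ _ _)
      (Category.assoc _ _ _)) ∘ (fun χ : Cell K h k L => comp p χ) =
      (fun χ : Cell K (h ≫ a) (k ≫ b) L' => comp p χ) ∘ fun χ => compTo (.of χ) c rfl rfl :=
    funext fun χ => compTo_assoc p χ c rfl rfl rfl rfl _ _ rfl rfl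
  exact (Function.Bijective.of_comp_iff' b₂ _).symm.trans
    ((iff_of_eq (congrArg _ e)).trans (Function.Bijective.of_comp_iff _ b₁))

theorem IsCocartesian.comp_horIso {s : Strength} {t : Arity} {A B C : Ob}
    {J : HPath (Hor (Ob := Ob)) A B} {f : A ⟶ C} {K L : Hor C B}
    {ρ : Cell J f (𝟙 B) (.single K)} (hρ : IsCocartesian s t (CellPath.of ρ))
    {σ : Cell (.cons K (.nil B)) (𝟙 C) (𝟙 B) (.single L)} (hσ : IsHorIso σ) :
    IsCocartesian s t
      (CellPath.of (compTo (.of ρ) σ (Category.comp_id _) (Category.comp_id _))) := by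
  refine isCocartesian_iff.2 ?_
  intro E H hH J' hJ
  refine isWeaklyCocartesian_iff.2 ?_
  intro X Y h k N hN
  have b₁ := (isWeaklyCocartesian_iff.1 (isCocartesian_iff.1 hρ H hH hJ) h k N
    hN).compTo_bijective rfl (Category.id_comp k)
  have b₃ := b₁.comp (hσ.whisker_bijective H h k N (Category.id_comp h) (Category.id_comp k))
  have e : (fun χ : Cell (.cons L H) h k N => compTo (whisker
      (compTo (.of ρ) σ (Category.comp_id _) (Category.comp_id _)) H hJ) χ rfl
        (Category.id_comp k)) = _ :=
    funext fun χ => compTo_whisker ρ σ H hJ χ (Category.comp_id _) (Category.comp_id _)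
      (Category.id_comp h) rfl (Category.id_comp k) rfl
  refine (Function.Bijective.of_comp_iff' (castCell_bijective rfl (Category.id_comp k)) _).1 ?_
  exact (iff_of_eq (congrArg _ e)).2 b₃

/-- The map `ζ ↦ (ε ∘ φ) ⊙ ζ` is the bijection `ζ ↦ ε ⊙ ζ` followed by composition with `(φ, id, …,
id)`. Hence Kan-ness of the composite depends on `ε` only through `d`. -/
theorem isKan_comp_iff {s : Strength} {A B C M : Ob} {J : HPath (Hor (Ob := Ob)) A B} {f : A ⟶ C}
    {K : Hor C B} {φ : Cell J f (𝟙 B) (.single K)} {d : C ⟶ M} {l : B ⟶ M}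
    {ε : Cell (.cons K (.nil B)) d l (.empty M)} (hε : IsKan s ε) {a : A ⟶ M} (ha : f ≫ d = a)
    (hl : 𝟙 B ≫ l = l) :
    IsKan s (compTo (.of φ) ε ha hl) ↔ ∀ ⦃E : Ob⦄ (H : HPath Hor B E), s.Allows H →
      ∀ ⦃J' : HPath Hor A E⦄ (hJ : J' = J.append H) (k : E ⟶ M),
        CocartesianAt (whisker φ H hJ) d k (.empty M) := by
  subst ha
  refine isKan_iff.trans (forall₅_congr fun E H hH J' hJ => forall_congr' fun k => ?_)
  have b := isKan_iff.1 hε H hH (J' := .cons K H) rfl k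
  have e : (fun ζ : Cell H l k (.empty M) => hcomp (compTo (.of φ) ε rfl hl) ζ hJ) =
      (castCell rfl (Category.id_comp k) ∘ fun χ => comp (whisker φ H hJ) χ) ∘
        fun ζ => hcomp ε ζ rfl := by
    funext ζ
    -- Interchange applies once `ζ` is rewritten as `ζ ∘ (id, …, id)`.
    have e₁ := compTo_hcomp (CellPath.of φ) (ids H) ε ζ hJ rfl rfl hl (Category.id_comp k)
    have e₂ := compTo_ids ζ (Category.id_comp _) (Category.id_comp _)
    exact (congrArg (fun z => hcomp (compTo (.of φ) ε rfl hl) z hJ) e₂).symm.trans e₁.symm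
  exact (iff_of_eq (congrArg _ e)).trans ((Function.Bijective.of_comp_iff _ b).trans
    (Function.Bijective.of_comp_iff' (castCell_bijective _ _) _))

theorem IsKan.comp_of_isCocartesian {s : Strength} {A B C M : Ob}
    {J : HPath (Hor (Ob := Ob)) A B} {f : A ⟶ C} {K : Hor C B} {φ : Cell J f (𝟙 B) (.single K)}
    {d : C ⟶ M} {l : B ⟶ M} {ε : Cell (.cons K (.nil B)) d l (.empty M)} (hε : IsKan s ε)
    (hφ : IsCocartesian s .nullary (CellPath.of φ)) {a : A ⟶ M} (ha : f ≫ d = a)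
    (hl : 𝟙 B ≫ l = l) : IsKan s (compTo (.of φ) ε ha hl) :=
  (isKan_comp_iff hε ha hl).2 fun _ H hH _ hJ k =>
    isWeaklyCocartesian_iff.1 (isCocartesian_iff.1 hφ H hH hJ) d k _ trivial

/-- The cartesian cell that the Yoneda axiom supplies for `K` is Kan by density, so it differs from
`η` by an invertible vertical cell. -/
theorem IsYoneda.isRestriction {s : Strength} {B C P : Ob} {y : C ⟶ P}
    (hy : IsYoneda (Ob := Ob) s y)
    {K : Hor C B} {l : B ⟶ P} {η : Cell (.cons K (.nil B)) y l (.empty P)} (hη : IsKan s η) :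
    IsRestriction η := by
  obtain ⟨l', ε, hε⟩ := hy.2 K
  obtain ⟨θ, hθ, rfl⟩ := (hy.1 K l' ε hε).exists_vertIso hη
  exact IsCartesian.hcomp_vertIso (J := .single K) hε hθ

theorem IsYoneda.isCocartesian_unary {s : Strength} {A B C P : Ob} {y : C ⟶ P}
    (hy : IsYoneda (Ob := Ob) s y) (hC : HasRestrictionsOnLeftFrom (Ob := Ob) C)
    {J : HPath (Hor (Ob := Ob)) A B} {f : A ⟶ C} {K : Hor C B} {φ : Cell J f (𝟙 B) (.single K)}
    {l : B ⟶ P} {ε : Cell (.cons K (.nil B)) y l (.empty P)} (hε : IsRestriction ε) {a : A ⟶ P}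
    (ha : f ≫ y = a) (hl : 𝟙 B ≫ l = l) (hk : IsKan s (compTo (.of φ) ε ha hl)) :
    IsCocartesian s .unary (CellPath.of φ) := by
  refine isCocartesian_iff.2 fun E H hH J' hJ => isWeaklyCocartesian_iff.2 ?_
  rintro X Y h k (_ | L) hL
  · exact hL.elim
  -- First `L` is replaced by `L(h, id)`, whose vertical source is trivial; then `L(h, id)` is
  -- presented as `P(y, m)`. The test cells become nullary with vertical source `y`.
  obtain ⟨L', c, hc⟩ := hC L h
  obtain ⟨m, δ, hδ⟩ := hy.2 L'
  refine (cocartesianAt_cartesian_iff _ (L := .single L') hc (Category.id_comp h)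
    (Category.comp_id k)).1 ?_
  refine (cocartesianAt_cartesian_iff _ (L := .single L') hδ (Category.id_comp y) rfl).2 ?_
  exact (isKan_comp_iff (hy.1 K l ε hε) ha hl).1 hk H hH hJ _

theorem IsYoneda.isKan_comp {s : Strength} {A B C P : Ob} {y : C ⟶ P}
    (hy : IsYoneda (Ob := Ob) s y) (hP : AdmitsNullaryRestrictions (Ob := Ob) y)
    {J : HPath (Hor (Ob := Ob)) A B} {f : A ⟶ C} {K : Hor C B} {φ : Cell J f (𝟙 B) (.single K)}
    (hφ : IsCocartesian s .unary (CellPath.of φ)) {l : B ⟶ P}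
    {ε : Cell (.cons K (.nil B)) y l (.empty P)} (hε : IsRestriction ε) {a : A ⟶ P}
    (ha : f ≫ y = a) (hl : 𝟙 B ≫ l = l) : IsKan s (compTo (.of φ) ε ha hl) := by
  refine (isKan_comp_iff (hy.1 K l ε hε) ha hl).2 fun E H hH J' hJ k => ?_
  obtain ⟨L, c, hc⟩ := hP k
  refine (cocartesianAt_cartesian_iff _ (L := .single L) hc (Category.id_comp y)
    (Category.id_comp k)).1 ?_
  refine isWeaklyCocartesian_iff.1 (isCocartesian_iff.1 hφ H hH hJ) _ _ _ trivial

theorem IsCocartesian.nullary_of_unary {s : Strength} (hU : IsUnital Ob) {A B C : Ob}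
    {J : HPath (Hor (Ob := Ob)) A B} {f : A ⟶ C} {K : Hor C B} {φ : Cell J f (𝟙 B) (.single K)}
    (hφ : IsCocartesian s .unary (CellPath.of φ)) : IsCocartesian s .nullary (CellPath.of φ) := by
  refine isCocartesian_iff.2 fun E H hH J' hJ => isWeaklyCocartesian_iff.2 ?_
  rintro X Y h k (_ | L) hL
  · obtain ⟨I, c, hc⟩ := hU X
    refine (cocartesianAt_cartesian_iff _ (L := .single I) hc (Category.comp_id h)
      (Category.comp_id k)).1 ?_
    exact isWeaklyCocartesian_iff.1 (isCocartesian_iff.1 hφ H hH hJ) _ _ _ trivial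
  · exact hL.elim

end Cocartesian

/-! ### Pointwise notions and invertibility of comparison cells -/

section Pointwise

variable {Ob : Type u} [Category.{v} Ob] [AugmentedVirtualDoubleCategory.{u, v, w, x} Ob]

open AugmentedVirtualDoubleCategory

theorem HPath.length_snoc {Ob : Type u} {H : Ob → Ob → Type w} {C : Ob} :
    {A B : Ob} → (p : HPath H A B) → (J : H B C) → (p.snoc J).length = p.length + 1
  | _, _, .nil _, _ => rfl
  | _, _, .cons _ p, J => congrArg Nat.succ (length_snoc p J)

/-- For a path of length one, `restrictLast` only puts a vertical identity in front of `c`. -/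
theorem isKan_restrictLast_nil_iff {s : Strength} {B C M X : Ob} {K : Hor (Ob := Ob) C B}
    {K₁ : Hor C X} {h : X ⟶ B} (c : Cell (.cons K₁ (.nil X)) (𝟙 C) h (.single K)) {d : C ⟶ M}
    {l : B ⟶ M} (η : Cell (.cons K (.nil B)) d l (.empty M)) {m : X ⟶ M} (hd : 𝟙 C ≫ d = d)
    (hm : h ≫ l = m) :
    IsKan s (comp (restrictLast (.nil C) rfl c) η) ↔ IsKan s (compTo (.of c) η hd hm) := by
  have e : comp (restrictLast (.nil C) rfl c) η = comp (.of c) η := comp_insert_left (.of c) η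
  exact (iff_of_eq (congrArg _ e)).trans (isKan_castCell hd hm).symm

theorem IsPointwiseKan.comp_restriction {s : Strength} {B C M X : Ob} {K : Hor (Ob := Ob) C B}
    {K₁ : Hor C X} {h : X ⟶ B} {c : Cell (.cons K₁ (.nil X)) (𝟙 C) h (.single K)}
    (hc : IsRestriction c) {d : C ⟶ M} {l : B ⟶ M} {η : Cell (.cons K (.nil B)) d l (.empty M)}
    (hη : IsPointwiseKan s η) {m : X ⟶ M} (hd : 𝟙 C ≫ d = d) (hm : h ≫ l = m) :
    IsKan s (compTo (.of c) η hd hm) :=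
  (isKan_restrictLast_nil_iff c η hd hm).1 (hη.2 (.nil C) K rfl h K₁ c hc)

/-- Restrictions of a cartesian cell are cartesian, hence Kan by density. -/
theorem IsYoneda.isPointwiseKan {s : Strength} {B C P : Ob} {y : C ⟶ P}
    (hy : IsYoneda (Ob := Ob) s y) {K : Hor C B} {l : B ⟶ P}
    {ε : Cell (.cons K (.nil B)) y l (.empty P)} (hε : IsRestriction ε) : IsPointwiseKan s ε := by
  refine ⟨hy.1 K l ε hε, ?_⟩
  intro Z J₀ Jn hJ X g Jn' c hc
  cases J₀ with
  | nil =>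
    cases hJ
    refine (isKan_restrictLast_nil_iff c ε (Category.id_comp y) rfl).2 ?_
    exact hy.1 _ _ _ (IsCartesian.comp (J := .single Jn') (K := .single K) hc hε _ _)
  | cons J p =>
    -- A path of length one has no last morphism preceded by a non-empty path.
    have e := (congrArg HPath.length hJ).trans (HPath.length_snoc _ Jn)
    exact absurd (Nat.succ.inj e).symm (Nat.succ_ne_zero _)

/-- Moves a restriction of the source of `ε ∘ φ` past `φ`: the result is the restriction of `ε`
along `h`, composed with `φ₁`. -/
theorem compTo_restriction_eq {A B C X : Ob} {J : HPath (Hor (Ob := Ob)) A B}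
    {J₁ : HPath Hor A X} {f : A ⟶ C} {h : X ⟶ B} {K : Hor C B} {K₁ : Hor C X}
    {p : CellPath J₁ (𝟙 A) h J} {φ : Cell J f (𝟙 B) (.single K)}
    {c : Cell (.cons K₁ (.nil X)) (𝟙 C) h (.single K)} {φ₁ : Cell J₁ f (𝟙 X) (.single K₁)}
    (e : compTo p φ (Category.id_comp f) (Category.comp_id h) =
      compTo (.of φ₁) c (Category.comp_id f) (Category.id_comp h))
    {Y Y' : Ob} {d : C ⟶ Y} {l : B ⟶ Y'} {N : Target Hor Y Y'}
    (ε : Cell (.cons K (.nil B)) d l N) {a : A ⟶ Y} {m : X ⟶ Y'} (ha : f ≫ d = a)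
    (hl : 𝟙 B ≫ l = l) (ha' : 𝟙 A ≫ a = a) (hm : h ≫ l = m) (hd : 𝟙 C ≫ d = d)
    (hm' : 𝟙 X ≫ m = m) :
    compTo p (compTo (.of φ) ε ha hl) ha' hm =
      compTo (.of φ₁) (compTo (.of c) ε hd hm) ha hm' :=
  (compTo_assoc p φ ε (Category.id_comp f) (Category.comp_id h) ha hl ha hm ha' hm).symm.trans
    ((congrArg (fun z => compTo (CellPath.of z) ε ha hm) e).trans
      (compTo_assoc (.of φ₁) c ε (Category.comp_id f) (Category.id_comp h) hd hm ha hm ha hm'))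

theorem IsPointwiseCocartesian.comp_horIso {s : Strength} {t : Arity} {A B C : Ob}
    {J : HPath (Hor (Ob := Ob)) A B} {f : A ⟶ C} {K L : Hor C B}
    {ρ : Cell J f (𝟙 B) (.single K)} (hρ : IsPointwiseCocartesian s t ρ)
    {σ : Cell (.cons K (.nil B)) (𝟙 C) (𝟙 B) (.single L)} (hσ : IsHorIso σ) :
    IsPointwiseCocartesian s t
      (compTo (.of ρ) σ (Category.comp_id _) (Category.comp_id _)) := by
  refine ⟨IsCocartesian.comp_horIso hρ.1 hσ, ?_⟩
  intro Z J₀ Jn hJ X h Jn' c hc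
  obtain ⟨K', c', ρ', hc', e, hρ'⟩ := hρ.2 J₀ Jn hJ h Jn' c hc
  exact ⟨K', compTo (.of c') σ (Category.comp_id _) (Category.comp_id _), ρ',
    IsCartesian.comp (J := .single K') (K := .single K) hc' hσ.isCartesian _ _,
    compTo_restriction_eq e σ _ _ _ _ _ _, hρ'⟩

/-- Reduces a pointwise claim to claims about single restrictions. The hypotheses `h₀` and `h₁`
leave open why those are Kan, which depends on the arity. -/
theorem IsPointwiseCocartesian.isPointwiseKan_comp {s : Strength} {t : Arity} {A B C M : Ob}
    {J : HPath (Hor (Ob := Ob)) A B} {f : A ⟶ C} {K : Hor C B} {φ : Cell J f (𝟙 B) (.single K)}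
    (hφ : IsPointwiseCocartesian s t φ) {d : C ⟶ M} {l : B ⟶ M}
    {ε : Cell (.cons K (.nil B)) d l (.empty M)} {a : A ⟶ M} (ha : f ≫ d = a)
    (hl : 𝟙 B ≫ l = l) (h₀ : IsKan s (compTo (.of φ) ε ha hl))
    (h₁ : ∀ ⦃X : Ob⦄ (h : X ⟶ B) (K₁ : Hor C X)
      (c : Cell (.cons K₁ (.nil X)) (𝟙 C) h (.single K)) (J₁ : HPath Hor A X)
      (φ₁ : Cell J₁ f (𝟙 X) (.single K₁)), IsRestriction c →
        IsCocartesian s t (CellPath.of φ₁) → IsKan s (compTo (.of φ₁)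
          (compTo (.of c) ε (Category.id_comp d) rfl) ha (Category.id_comp _))) :
    IsPointwiseKan s (compTo (.of φ) ε ha hl) := by
  refine ⟨h₀, ?_⟩
  intro Z J₀ Jn hJ X h Jn' c hc
  obtain ⟨K', c', φ₁, hc', e, hφ₁⟩ := hφ.2 J₀ Jn hJ h Jn' c hc
  refine (isKan_castCell (Category.id_comp a) rfl).1 ?_
  exact (iff_of_eq (congrArg (IsKan s) (compTo_restriction_eq e ε ha hl (Category.id_comp a) rfl
    (Category.id_comp d) (Category.id_comp _)))).2 (h₁ h K' c' _ φ₁ hc' hφ₁)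

theorem IsCocartesian.cocartesianAt {s : Strength} {t : Arity} {A B C D X Y : Ob}
    {J : HPath (Hor (Ob := Ob)) A B} {f : A ⟶ C} {g : B ⟶ D} {K : HPath Hor C D}
    {p : CellPath J f g K} (hp : IsCocartesian s t p) (h : C ⟶ X) (k : D ⟶ Y)
    {L : Target Hor X Y} (hL : L.HasArity t) : CocartesianAt p h k L := by
  cases s
  · exact isWeaklyCocartesian_iff.1 hp.1 h k L hL
  · exact isWeaklyCocartesian_iff.1 hp h k L hL

theorem IsCocartesian.isHorIso {s : Strength} {A B C : Ob}
    {J : HPath (Hor (Ob := Ob)) A B} {f : A ⟶ C} {K L : Hor C B}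
    {ρ : Cell J f (𝟙 B) (.single K)} (hρ : IsCocartesian s .unary (CellPath.of ρ))
    {σ : Cell (.cons K (.nil B)) (𝟙 C) (𝟙 B) (.single L)} {hf : f ≫ 𝟙 C = f}
    {hB : 𝟙 B ≫ 𝟙 B = 𝟙 B} (hσ : IsCocartesian s .unary (CellPath.of (compTo (.of ρ) σ hf hB))) :
    IsHorIso σ := by
  have hC := Category.comp_id (𝟙 C)
  have b₁ : ∀ N : Hor C B, _ := fun N =>
    (hρ.cocartesianAt (𝟙 C) (𝟙 B) (L := .single N) trivial).compTo_bijective hf hB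
  have b₂ : ∀ N : Hor C B, _ := fun N =>
    (hσ.cocartesianAt (𝟙 C) (𝟙 B) (L := .single N) trivial).compTo_bijective hf hB
  obtain ⟨τ, hτ⟩ := (b₂ K).2 ρ
  refine ⟨τ, (b₁ K).1 ?_, (b₂ L).1 ?_⟩
  · exact (compTo_assoc (.of ρ) σ τ hf hB hC hB hf hB hf hB).symm.trans
      (Eq.trans hτ (compTo_hid ρ hf hB).symm)
  · exact (compTo_assoc (.of (compTo (.of ρ) σ hf hB)) τ σ hf hB hC hB hf hB hf hB).symm.trans
      ((congrArg (fun z => compTo (CellPath.of z) σ hf hB) hτ).trans (compTo_hid _ hf hB).symm)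

/-- With `δ` presenting `K` through `y`, both `δ ∘ ρ` and `ε ∘ σ ∘ ρ` are Kan with the same vertical
source, so they differ by an invertible `θ`. Cancelling the cocartesian `ρ` gives `δ ⊙ θ = ε ∘ σ`.
So `ε ∘ σ` is cartesian, hence so is `σ`, and a cartesian cell with trivial vertical morphisms is
invertible. -/
theorem IsYoneda.isHorIso {s : Strength} {A B C P : Ob} {y : C ⟶ P}
    (hy : IsYoneda (Ob := Ob) s y) {J : HPath (Hor (Ob := Ob)) A B} {f : A ⟶ C} {K L : Hor C B}
    {ρ : Cell J f (𝟙 B) (.single K)} (hρ : IsCocartesian s .nullary (CellPath.of ρ))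
    {σ : Cell (.cons K (.nil B)) (𝟙 C) (𝟙 B) (.single L)} {hf : f ≫ 𝟙 C = f}
    {hB : 𝟙 B ≫ 𝟙 B = 𝟙 B} {l : B ⟶ P} {ε : Cell (.cons L (.nil B)) y l (.empty P)}
    (hε : IsRestriction ε) {a : A ⟶ P} {ha : f ≫ y = a} {hl : 𝟙 B ≫ l = l}
    (hσ : IsKan s (compTo (.of (compTo (.of ρ) σ hf hB)) ε ha hl)) : IsHorIso σ := by
  obtain ⟨m, δ, hδ⟩ := hy.2 K
  have hm := Category.id_comp m
  have hyy := Category.id_comp y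
  have hδρ := IsKan.comp_of_isCocartesian (hy.1 K m δ hδ) hρ ha hm
  obtain ⟨θ, hθ, e⟩ := hδρ.exists_vertIso hσ
  have e₁ := compTo_assoc (.of ρ) σ ε hf hB hyy hl ha hl ha hl
  have e₂ := compTo_of_hcomp_vert (.of ρ) δ θ ha hm hl
  have e₃ : compTo (vidPath (𝟙 B)) θ hm hl = θ := compTo_ids θ hm hl
  have e₄ := e₂.trans ((congrArg (fun z => hcomp (compTo (CellPath.of ρ) δ ha hm) z
    (HPath.append_nil J).symm) e₃).trans (e.trans e₁))
  have e₅ := ((hρ.cocartesianAt y l (L := .empty P) trivial).compTo_bijective ha hl).1 e₄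
  have hδθ := IsCartesian.hcomp_vertIso (J := .single K) hδ hθ
  have hσε : IsRestriction (compTo (.of σ) ε hyy hl) :=
    (iff_of_eq (congrArg (IsCartesian (J := .single K)) e₅)).1 hδθ
  exact IsCartesian.isHorIso (IsCartesian.of_comp (J := .single K) (K := .single L) hσε hε)

/-- Restrictions are unique up to an invertible cell; this makes the Beck–Chevalley condition
independent of the choice of restriction. -/
theorem exists_horIso_of_factorsAs {A B C D : Ob} {J : HPath (Hor (Ob := Ob)) A B} {f : A ⟶ C}
    {g : B ⟶ D} {K : Target Hor C D} {φ : Cell J f g K} {K₁ K₂ : Hor C B}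
    {c₁ : Cell (.cons K₁ (.nil B)) (𝟙 C) g K} {c₂ : Cell (.cons K₂ (.nil B)) (𝟙 C) g K}
    {φ₁ : Cell J f (𝟙 B) (.single K₁)} {φ₂ : Cell J f (𝟙 B) (.single K₂)}
    (h₁ : IsRestriction c₁) (h₂ : IsRestriction c₂) (e₁ : FactorsAs φ c₁ φ₁)
    (e₂ : FactorsAs φ c₂ φ₂) :
    ∃ σ : Cell (.cons K₁ (.nil B)) (𝟙 C) (𝟙 B) (.single K₂), IsHorIso σ ∧
      compTo (.of φ₁) σ (Category.comp_id _) (Category.comp_id _) = φ₂ := by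
  have hC := Category.comp_id (𝟙 C)
  have hB := Category.comp_id (𝟙 B)
  have hf := Category.comp_id f
  have hg := Category.id_comp g
  have b := isCartesian_iff.1 h₂
  obtain ⟨σ, hσ⟩ := (b (𝟙 C) (𝟙 B) _ _ _ hC hg).2 c₁
  have hσ' : IsRestriction σ := by
    refine IsCartesian.of_comp (J := .single K₁) (K := .single K₂) (χ := c₂) (ha := hC)
      (hb := hg) ?_ h₂
    exact (iff_of_eq (congrArg (IsCartesian (J := .single K₁)) hσ)).2 h₁
  refine ⟨σ, IsCartesian.isHorIso hσ', (b f (𝟙 B) _ _ _ hf hg).1 ?_⟩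
  exact (compTo_assoc (.of φ₁) σ c₂ hf hB hC hg hf hg hf hg).trans
    ((congrArg (fun z => compTo (.of φ₁) z hf hg) hσ).trans (e₁.symm.trans e₂))

theorem exists_factor_of_hasRestriction {A B C D X : Ob} {J : HPath (Hor (Ob := Ob)) A B}
    {f : A ⟶ C} {g : B ⟶ D} {K : Hor C D} {K' : Hor C B}
    {cart : Cell (.cons K' (.nil B)) (𝟙 C) g (.single K)} (hcart : IsRestriction cart)
    (φ : Cell J f (𝟙 B) (.single K')) {h : X ⟶ B}
    (hr : HasRestriction (.single K) (𝟙 C) (h ≫ g)) {J₁ : HPath Hor A X}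
    (p : CellPath J₁ (𝟙 A) h J) :
    ∃ (K₁ : Hor C X) (c : Cell (.cons K₁ (.nil X)) (𝟙 C) h (.single K'))
      (φ₁ : Cell J₁ f (𝟙 X) (.single K₁)), IsRestriction c ∧
        compTo p φ (Category.id_comp f) (Category.comp_id h) =
          compTo (.of φ₁) c (Category.comp_id f) (Category.id_comp h) := by
  obtain ⟨K₁, c₁, hc₁⟩ := hr
  -- The cell defining the restriction of `K` along `h ≫ g` factors through `cart`, and by
  -- cancellation the factor defines `K'(id, h)`.
  obtain ⟨c, hc⟩ := (isCartesian_iff.1 hcart (𝟙 C) h _ _ _ (Category.comp_id _) rfl).2 c₁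
  have hc' : IsRestriction c := by
    refine IsCartesian.of_comp (J := .single K₁) (K := .single K') (χ := cart)
      (ha := Category.comp_id _) (hb := rfl) ?_ hcart
    exact (iff_of_eq (congrArg (IsCartesian (J := .single K₁)) hc)).2 hc₁
  obtain ⟨φ₁, hφ₁⟩ := (isCartesian_iff.1 hc' f (𝟙 X) J₁ _ _ (Category.comp_id f)
    (Category.id_comp h)).2 (compTo p φ (Category.id_comp f) (Category.comp_id h))
  exact ⟨K₁, c, φ₁, hc', hφ₁.symm⟩

end Pointwise

/-! ### The implications between the five conditions -/

section Exactness

variable {Ob : Type u} [Category.{v} Ob] [AugmentedVirtualDoubleCategory.{u, v, w, x} Ob]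
variable {s : Strength} {A B C D M P : Ob} {J : HPath (Hor (Ob := Ob)) A B} {f : A ⟶ C}
  {g : B ⟶ D} {K : Hor C D} {K' : Hor C B} {φ : Cell J f g (.single K)}
  {cart : Cell (.cons K' (.nil B)) (𝟙 C) g (.single K)} {φ' : Cell J f (𝟙 B) (.single K')}

theorem FactorsAs.comp_eq (hφ : FactorsAs φ cart φ') {d : C ⟶ M} {l : D ⟶ M}
    (η : Cell (.cons K (.nil D)) d l (.empty M)) :
    comp (.of φ) η = compTo (.of φ') (compTo (.of cart) η (Category.id_comp d) rfl) rfl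
      (Category.id_comp _) := by
  obtain rfl := hφ
  exact compTo_assoc (.of φ') cart η (Category.comp_id f) (Category.id_comp g)
    (Category.id_comp d) rfl rfl rfl rfl (Category.id_comp _)

theorem FactorsAs.isKan_iff (hφ : FactorsAs φ cart φ') {d : C ⟶ M} {l : D ⟶ M}
    (η : Cell (.cons K (.nil D)) d l (.empty M)) :
    IsKan s (comp (.of φ) η) ↔
      IsKan s (compTo (.of φ') (compTo (.of cart) η (Category.id_comp d) rfl) rfl
        (Category.id_comp _)) :=
  iff_of_eq (congrArg (IsKan s) (hφ.comp_eq η))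

theorem FactorsAs.isPointwiseKan_iff (hφ : FactorsAs φ cart φ') {d : C ⟶ M} {l : D ⟶ M}
    (η : Cell (.cons K (.nil D)) d l (.empty M)) :
    IsPointwiseKan s (comp (.of φ) η) ↔
      IsPointwiseKan s (compTo (.of φ') (compTo (.of cart) η (Category.id_comp d) rfl) rfl
        (Category.id_comp _)) :=
  iff_of_eq (congrArg (IsPointwiseKan s) (hφ.comp_eq η))

theorem isRestriction_comp (hcart : IsRestriction cart) {y : C ⟶ P} {l : D ⟶ P}
    {ε : Cell (.cons K (.nil D)) y l (.empty P)} (hε : IsRestriction ε) {m : B ⟶ P}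
    (hy : 𝟙 C ≫ y = y) (hm : g ≫ l = m) : IsRestriction (compTo (.of cart) ε hy hm) :=
  IsCartesian.comp (J := .single K') (K := .single K) hcart hε _ _

theorem leftBeckChevalley_iff (hcart : IsRestriction cart) (hφ : FactorsAs φ cart φ') :
    IsCocartesian s .nullary (CellPath.of φ') ↔ LeftBeckChevalley s φ := by
  refine ⟨fun h => ⟨K', cart, φ', hcart, hφ, h⟩, ?_⟩
  rintro ⟨K₁, c₁, φ₁, h₁, e₁, h⟩
  obtain ⟨σ, hσ, rfl⟩ := exists_horIso_of_factorsAs h₁ hcart e₁ hφ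
  exact IsCocartesian.comp_horIso h hσ

theorem pointwiseLeftBeckChevalley_iff (hcart : IsRestriction cart)
    (hφ : FactorsAs φ cart φ') :
    IsPointwiseCocartesian s .nullary φ' ↔ PointwiseLeftBeckChevalley s φ := by
  refine ⟨fun h => ⟨K', cart, φ', hcart, hφ, h⟩, ?_⟩
  rintro ⟨K₁, c₁, φ₁, h₁, e₁, h⟩
  obtain ⟨σ, hσ, rfl⟩ := exists_horIso_of_factorsAs h₁ hcart e₁ hφ
  exact IsPointwiseCocartesian.comp_horIso h hσ

theorem isLeftExactAt_of_isCocartesian (hcart : IsRestriction cart) (hφ : FactorsAs φ cart φ')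
    (h : IsCocartesian s .nullary (CellPath.of φ')) {d : C ⟶ M}
    (hd : KanExtensionRestricts s d (.nil C) K g) : IsLeftExactAt s (CellPath.of φ) d := by
  intro l η hη
  have hc := (isKan_restrictLast_nil_iff cart η (Category.id_comp d) rfl).1
    (hd.2 l η hη K' cart hcart)
  exact (hφ.isKan_iff η).2 (hc.comp_of_isCocartesian h rfl (Category.id_comp _))

theorem isPointwiseLeftExact_of_isPointwiseCocartesian (hcart : IsRestriction cart)
    (hφ : FactorsAs φ cart φ') (h : IsPointwiseCocartesian s .nullary φ') :
    IsPointwiseLeftExact s (CellPath.of φ) := by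
  intro M d l η hη
  refine (hφ.isPointwiseKan_iff η).2 (h.isPointwiseKan_comp rfl (Category.id_comp _) ?_ ?_)
  · exact (hη.comp_restriction hcart (Category.id_comp d) rfl).comp_of_isCocartesian h.1 _ _
  · intro X k K₁ c J₁ φ₁ hc hφ₁
    refine IsKan.comp_of_isCocartesian ?_ hφ₁ _ _
    -- Restricting `η` along `g` and then along `k` is restricting it once, along `k ≫ g`, which the
    -- pointwise hypothesis covers.
    have hcc := IsCartesian.comp (J := .single K₁) (K := .single K') hc hcart
      (Category.comp_id _) rfl
    have e := compTo_assoc (.of c) cart η (Category.comp_id _) rfl (Category.id_comp d) rfl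
      (Category.id_comp d) (Category.assoc k g l) (Category.id_comp d) rfl
    exact (iff_of_eq (congrArg (IsKan s) e)).1
      (hη.comp_restriction hcc (Category.id_comp d) (Category.assoc k g l))

theorem IsYoneda.kanExtensionRestricts {y : C ⟶ P} (hy : IsYoneda (Ob := Ob) s y)
    (hcart : IsRestriction cart) : KanExtensionRestricts s y (.nil C) K g := by
  refine ⟨⟨K', cart, hcart⟩, fun l η hη Jn' c hc => ?_⟩
  exact (isKan_restrictLast_nil_iff c η (Category.id_comp y) rfl).2
    (hy.1 _ _ _ (isRestriction_comp hc (hy.isRestriction hη) _ _))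

/-- Exactness at `y` is only tested on the Yoneda presentation of `K`; restricted along `g`, it
presents `K'`. -/
theorem IsYoneda.exists_isKan_comp {y : C ⟶ P} (hy : IsYoneda (Ob := Ob) s y)
    (hcart : IsRestriction cart) (hφ : FactorsAs φ cart φ')
    (h : IsLeftExactAt s (CellPath.of φ) y) :
    ∃ (l : B ⟶ P) (ε : Cell (.cons K' (.nil B)) y l (.empty P)), IsRestriction ε ∧
      IsKan s (compTo (.of φ') ε rfl (Category.id_comp l)) := by
  obtain ⟨l, ε, hε⟩ := hy.2 K
  exact ⟨_, _, isRestriction_comp hcart hε (Category.id_comp y) rfl,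
    (hφ.isKan_iff ε).1 (h l ε (hy.1 K l ε hε))⟩

theorem IsYoneda.exists_isPointwiseKan_comp {y : C ⟶ P} (hy : IsYoneda (Ob := Ob) s y)
    (hcart : IsRestriction cart) (hφ : FactorsAs φ cart φ')
    (h : IsPointwiseLeftExactAt s (CellPath.of φ) y) :
    ∃ (l : B ⟶ P) (ε : Cell (.cons K' (.nil B)) y l (.empty P)), IsRestriction ε ∧
      IsPointwiseKan s (compTo (.of φ') ε rfl (Category.id_comp l)) := by
  obtain ⟨l, ε, hε⟩ := hy.2 K
  exact ⟨_, _, isRestriction_comp hcart hε (Category.id_comp y) rfl,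
    (hφ.isPointwiseKan_iff ε).1 (h l ε (hy.isPointwiseKan hε))⟩

theorem IsYoneda.isPointwiseCocartesian_unary {y : C ⟶ P} (hy : IsYoneda (Ob := Ob) s y)
    (hC : HasRestrictionsOnLeftFrom (Ob := Ob) C) (hcart : IsRestriction cart)
    (hK : ∀ ⦃X : Ob⦄ (h : X ⟶ B), HasRestriction (.single K) (𝟙 C) (h ≫ g)) {l : B ⟶ P}
    {ε : Cell (.cons K' (.nil B)) y l (.empty P)} (hε : IsRestriction ε)
    (h : IsPointwiseKan s (compTo (.of φ') ε rfl (Category.id_comp l))) :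
    IsPointwiseCocartesian s .unary φ' := by
  refine ⟨hy.isCocartesian_unary hC hε _ _ h.1, ?_⟩
  intro Z J₀ Jn hJ X k Jn' c hc
  -- The existence of these restrictions is part of the conclusion; it comes from the restrictions
  -- of `K` along `k ≫ g`.
  obtain ⟨K₁, c₁, φ₁, hc₁, e⟩ :=
    exists_factor_of_hasRestriction hcart φ' (hK k) (restrictLast J₀ hJ c)
  refine ⟨K₁, c₁, φ₁, hc₁, e, ?_⟩
  refine hy.isCocartesian_unary hC (isRestriction_comp hc₁ hε (Category.id_comp y) rfl) rfl
    (Category.id_comp _) ?_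
  exact (iff_of_eq (congrArg (IsKan s) (compTo_restriction_eq e ε rfl (Category.id_comp l)
    (Category.id_comp _) rfl (Category.id_comp y) (Category.id_comp _)))).1
    ((isKan_castCell (Category.id_comp _) rfl).2 (h.2 J₀ Jn hJ k Jn' c hc))

theorem IsYoneda.isLeftExactAt {y : C ⟶ P} (hy : IsYoneda (Ob := Ob) s y)
    (hP : AdmitsNullaryRestrictions (Ob := Ob) y) (hcart : IsRestriction cart)
    (hφ : FactorsAs φ cart φ') (h : IsCocartesian s .unary (CellPath.of φ')) :
    IsLeftExactAt s (CellPath.of φ) y := fun _ η hη =>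
  (hφ.isKan_iff η).2 (hy.isKan_comp hP h
    (isRestriction_comp hcart (hy.isRestriction hη) _ _) _ _)

theorem IsYoneda.isPointwiseLeftExactAt {y : C ⟶ P} (hy : IsYoneda (Ob := Ob) s y)
    (hP : AdmitsNullaryRestrictions (Ob := Ob) y) (hcart : IsRestriction cart)
    (hφ : FactorsAs φ cart φ') (h : IsPointwiseCocartesian s .unary φ') :
    IsPointwiseLeftExactAt s (CellPath.of φ) y := by
  intro l η hη
  have hε := isRestriction_comp hcart (hy.isRestriction hη.1) (Category.id_comp y) rfl
  refine (hφ.isPointwiseKan_iff η).2 (h.isPointwiseKan_comp rfl (Category.id_comp _) ?_ ?_)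
  · exact hy.isKan_comp hP h.1 hε _ _
  · intro X k K₁ c J₁ φ₁ hc hφ₁
    exact hy.isKan_comp hP hφ₁ (isRestriction_comp hc hε _ _) _ _

theorem IsPointwiseCocartesian.nullary_of_unary (hU : IsUnital Ob)
    (h : IsPointwiseCocartesian s .unary φ') : IsPointwiseCocartesian s .nullary φ' := by
  refine ⟨IsCocartesian.nullary_of_unary hU h.1, ?_⟩
  intro Z J₀ Jn hJ X k Jn' c hc
  obtain ⟨K₁, c₁, φ₁, hc₁, e, hφ₁⟩ := h.2 J₀ Jn hJ k Jn' c hc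
  exact ⟨K₁, c₁, φ₁, hc₁, e, IsCocartesian.nullary_of_unary hU hφ₁⟩

theorem IsCocartesian.exists_eq_comp {K'' : Hor C B} {ρ : Cell J f (𝟙 B) (.single K'')}
    (hρ : IsCocartesian s .unary (CellPath.of ρ)) (φ' : Cell J f (𝟙 B) (.single K')) :
    ∃ σ : Cell (.cons K'' (.nil B)) (𝟙 C) (𝟙 B) (.single K'),
      compTo (.of ρ) σ (Category.comp_id _) (Category.comp_id _) = φ' :=
  ((hρ.cocartesianAt (𝟙 C) (𝟙 B) (L := .single K') trivial).compTo_bijective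
    (Category.comp_id _) (Category.comp_id _)).2 φ'

end Exactness

end AVDC

/-! ### The theorem -/

open AVDC AVDC.CellData in
theorem mainTheorem9 {Ob : Type u} [Category.{v} Ob]
    [AugmentedVirtualDoubleCategory.{u, v, w, x} Ob] (s : Strength)
    {A₀ An C D P : Ob} (y : C ⟶ P) (hy : IsYoneda s y)
    (J : HPath (Hor (Ob := Ob)) A₀ An) (f : A₀ ⟶ C) (g : An ⟶ D) (K : Hor C D)
    (hf : (∃ h : A₀ = C, f = eqToHom h) ∨ HasConjoint f)
    (φ : Cell J f g (.single K))
    (K' : Hor C An) (cart : Cell (.cons K' (.nil An)) (𝟙 C) g (.single K))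
    (hcart : IsRestriction cart)
    (φ' : Cell J f (𝟙 An) (.single K')) (hφ : FactorsAs φ cart φ') :
    ((IsCocartesian s .nullary (CellPath.of φ') ↔ LeftBeckChevalley s φ) ∧
      (LeftBeckChevalley s φ →
        ∀ ⦃M : Ob⦄ (d : C ⟶ M), KanExtensionRestricts s d (.nil C) K g →
          IsLeftExactAt s (CellPath.of φ) d) ∧
      ((∀ ⦃M : Ob⦄ (d : C ⟶ M), KanExtensionRestricts s d (.nil C) K g →
          IsLeftExactAt s (CellPath.of φ) d) →
        IsLeftExactAt s (CellPath.of φ) y) ∧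
      (HasRestrictionsOnLeftFrom C → IsLeftExactAt s (CellPath.of φ) y →
        IsCocartesian s .unary (CellPath.of φ')) ∧
      (AdmitsNullaryRestrictions y → IsCocartesian s .unary (CellPath.of φ') →
        IsLeftExactAt s (CellPath.of φ) y) ∧
      (((∃ (K'' : Hor C An) (ρ : Cell J f (𝟙 An) (.single K'')),
            ∀ t, IsCocartesian s t (CellPath.of ρ)) ∨
          (IsUnital Ob ∧ HasRestrictionsOnLeftFrom C)) →
        List.TFAE [
          IsCocartesian s .nullary (CellPath.of φ'),
          LeftBeckChevalley s φ,
          ∀ ⦃M : Ob⦄ (d : C ⟶ M), KanExtensionRestricts s d (.nil C) K g →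
            IsLeftExactAt s (CellPath.of φ) d,
          IsLeftExactAt s (CellPath.of φ) y,
          IsCocartesian s .unary (CellPath.of φ')])) ∧
    (0 < J.length →
      (∀ ⦃X : Ob⦄ (h : X ⟶ An), HasRestriction (.single K) (𝟙 C) (h ≫ g)) →
      (IsPointwiseCocartesian s .nullary φ' ↔ PointwiseLeftBeckChevalley s φ) ∧
      (PointwiseLeftBeckChevalley s φ → IsPointwiseLeftExact s (CellPath.of φ)) ∧
      (IsPointwiseLeftExact s (CellPath.of φ) → IsPointwiseLeftExactAt s (CellPath.of φ) y) ∧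
      (HasRestrictionsOnLeftFrom C → IsPointwiseLeftExactAt s (CellPath.of φ) y →
        IsPointwiseCocartesian s .unary φ') ∧
      (AdmitsNullaryRestrictions y → IsPointwiseCocartesian s .unary φ' →
        IsPointwiseLeftExactAt s (CellPath.of φ) y) ∧
      (((∃ (K'' : Hor C An) (ρ : Cell J f (𝟙 An) (.single K'')),
            ∀ t, IsPointwiseCocartesian s t ρ) ∨
          (IsUnital Ob ∧ HasRestrictionsOnLeftFrom C)) →
        List.TFAE [
          IsPointwiseCocartesian s .nullary φ',
          PointwiseLeftBeckChevalley s φ,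
          IsPointwiseLeftExact s (CellPath.of φ),
          IsPointwiseLeftExactAt s (CellPath.of φ) y,
          IsPointwiseCocartesian s .unary φ'])) := by
  constructor
  · have hab := leftBeckChevalley_iff (s := s) hcart hφ
    have hbc : LeftBeckChevalley s φ → ∀ ⦃M : Ob⦄ (d : C ⟶ M),
        KanExtensionRestricts s d (.nil C) K g → IsLeftExactAt s (CellPath.of φ) d :=
      fun h _ _ hd => isLeftExactAt_of_isCocartesian hcart hφ (hab.2 h) hd
    have hcd : (∀ ⦃M : Ob⦄ (d : C ⟶ M), KanExtensionRestricts s d (.nil C) K g →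
        IsLeftExactAt s (CellPath.of φ) d) → IsLeftExactAt s (CellPath.of φ) y :=
      fun h => h y (hy.kanExtensionRestricts hcart)
    have hde : HasRestrictionsOnLeftFrom C → IsLeftExactAt s (CellPath.of φ) y →
        IsCocartesian s .unary (CellPath.of φ') := by
      intro hC h
      obtain ⟨l, ε, hε, hk⟩ := hy.exists_isKan_comp hcart hφ h
      exact hy.isCocartesian_unary hC hε _ _ hk
    refine ⟨hab, hbc, hcd, hde, fun hP h => hy.isLeftExactAt hP hcart hφ h, ?_⟩
    rintro (⟨K'', ρ, hρ⟩ | ⟨hU, hC⟩)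
    -- Unary-cocartesianness of `ρ` yields `φ' = σ ∘ ρ`. Conditions 4 and 5 each force `σ` to be
    -- invertible, and then `φ'` is cocartesian of both arities.
    · obtain ⟨σ, rfl⟩ := (hρ .unary).exists_eq_comp φ'
      tfae_have 1 ↔ 2 := hab
      tfae_have 2 → 3 := hbc
      tfae_have 3 → 4 := hcd
      tfae_have 4 → 5 := by
        intro h
        obtain ⟨l, ε, hε, hk⟩ := hy.exists_isKan_comp hcart hφ h
        exact (hρ .unary).comp_horIso (hy.isHorIso (hρ .nullary) hε hk)
      tfae_have 5 → 1 := fun h => (hρ .nullary).comp_horIso ((hρ .unary).isHorIso h)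
      tfae_finish
    · tfae_have 1 ↔ 2 := hab
      tfae_have 2 → 3 := hbc
      tfae_have 3 → 4 := hcd
      tfae_have 4 → 5 := hde hC
      tfae_have 5 → 1 := fun h => h.nullary_of_unary hU
      tfae_finish
  · intro _ hK
    have hab := pointwiseLeftBeckChevalley_iff (s := s) hcart hφ
    have hbc : PointwiseLeftBeckChevalley s φ → IsPointwiseLeftExact s (CellPath.of φ) :=
      fun h => isPointwiseLeftExact_of_isPointwiseCocartesian hcart hφ (hab.2 h)
    have hcd : IsPointwiseLeftExact s (CellPath.of φ) →
        IsPointwiseLeftExactAt s (CellPath.of φ) y := fun h => h y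
    have hde : HasRestrictionsOnLeftFrom C → IsPointwiseLeftExactAt s (CellPath.of φ) y →
        IsPointwiseCocartesian s .unary φ' := by
      intro hC h
      obtain ⟨l, ε, hε, hk⟩ := hy.exists_isPointwiseKan_comp hcart hφ h
      exact hy.isPointwiseCocartesian_unary hC hcart hK hε hk
    refine ⟨hab, hbc, hcd, hde, fun hP h => hy.isPointwiseLeftExactAt hP hcart hφ h, ?_⟩
    rintro (⟨K'', ρ, hρ⟩ | ⟨hU, hC⟩)
    -- Invertibility of `σ` uses only the non-pointwise halves of the hypotheses; the pointwise
    -- property then transfers from `ρ`.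
    · obtain ⟨σ, rfl⟩ := (hρ .unary).1.exists_eq_comp φ'
      tfae_have 1 ↔ 2 := hab
      tfae_have 2 → 3 := hbc
      tfae_have 3 → 4 := hcd
      tfae_have 4 → 5 := by
        intro h
        obtain ⟨l, ε, hε, hk⟩ := hy.exists_isPointwiseKan_comp hcart hφ h
        exact (hρ .unary).comp_horIso (hy.isHorIso (hρ .nullary).1 hε hk.1)
      tfae_have 5 → 1 := fun h => (hρ .nullary).comp_horIso ((hρ .unary).1.isHorIso h.1)
      tfae_finish
    · tfae_have 1 ↔ 2 := hab
      tfae_have 2 → 3 := hbc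
      tfae_have 3 → 4 := hcd
      tfae_have 4 → 5 := hde hC
      tfae_have 5 → 1 := fun h => h.nullary_of_unary hU
      tfae_finish
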